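/- **Setting.** Let $A,B\in\mathbb R^{n\times n}$ with $A$ Hurwitz (all eigenvalues have negative real part) and $BB^\top\succ0$, let $\Sigma_0\succ 0$, and let $x_t$, $t\ge 0$, solve $dx_t=Ax_t\,dt+B\,dw_t$, $x_0\sim\mathcal N(0,\Sigma_0)$, with $w$ a standard $n$-dimensional Brownian motion independent of $x_0$. Fix $\tau>0$ and put $x(k)=x_{k\tau}$, $k=0,1,2,\dots$ A *causal encoding policy* is a sequence of Markov kernels $\mathbb P[a(k)\mid a(0{:}k-1),x(0{:}k)]$ with values in the set $\{0,1\}^*$ of finite binary strings (the empty string included); given the past packets and the source, the law of $a(k)$ depends only on $a(0{:}k-1)$ and $x(0{:}k)$. Let $\ell(a)$ be the length of $a$, and let $\hat x_t=\mathbb E[x_t\mid a(0{:}\lfloor t/\tau\rfloor)]$. Define $$\mathcal L^*_{\rm CT}(D_c,\tau)=\inf\Big\{\limsup_{K\to\infty}\tfrac1{K\tau}\sum_{k=0}^{K-1}\mathbb E[\ell(a(k))]\ :\ \limsup_{T\to\infty}\tfrac1T\int_0^T\mathbb E\|x_t-\hat x_t\|_2^2\,dt\le D_c\Big\},$$ the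 infimum being over all causal encoding policies. For $s\ge0$ let $A_s=e^{As}$, $B_s=\big(\int_0^s e^{A\lambda}BB^\top e^{A^\top\lambda}d\lambda\big)^{1/2}$, and let $$\bar Q_{A,\tau}=\int_0^\tau e^{A^\top t}e^{At}dt,\qquad \bar b_\tau=\operatorname{Tr}\int_0^\tau B_tB_t^\top dt,\qquad D_{d,\tau}=D_c\tau-\bar b_\tau .$$ Consider the discrete-time source $x(0)\sim\mathcal N(0,\Sigma_0)$, $x(k+1)=A_\tau x(k)+B_\tau w(k)$, with $w(k)$ i.i.d. standard Gaussian in $\mathbb R^n$ and independent of $x(0)$, and write $\|v\|_Q^2=v^\top Qv$. Let $$\mathcal L^*_{\rm DT}(D,Q,\tau)=\inf\Big\{\limsup_{K\to\infty}\tfrac1{K\tau}\sum_{k=0}^{K-1}\mathbb E[\ell(a(k))]\ :\ \limsup_{K\to\infty}\tfrac1K\sum_{k=0}^{K-1}\mathbb E\|x(k)-\hat x(k)\|_Q^2\le D\Big\},$$ the infimum being over all causal encoding policies, with $\hat x(k)=\mathbb E[x(k)\mid a(0{:}k)]$, and let $$R(D,Q,\tau)=\inf\Big\{\limsup_{K\to\infty}\tfrac1K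 I\big(x(0{:}K-1);\hat x(0{:}K-1)\big)\ :\ \limsup_{K\to\infty}\tfrac1K\sum_{k=0}^{K-1}\mathbb E\|x(k)-\hat x(k)\|_Q^2\le D\Big\},$$ the infimum being over all causal reconstruction policies, i.e. sequences of Markov kernels $\mathbb P[\hat x(k)\mid\hat x(0{:}k-1),x(0{:}k)]$ on $\mathbb R^n$, with the mutual information $I$ in bits. All these quantities take values in $[0,\infty]$, and $\inf\emptyset=\infty$. **Theorem.** The function $\theta(x)=x+(1+x)\log_2(1+x)-x\log_2 x$ (with $0\log_2 0=0$) is strictly increasing and concave on $[0,\infty)$ and maps $[0,\infty)$ bijectively onto itself; let $\theta^{-1}$ be its inverse, with $\theta^{-1}(\infty)=\infty$. For every $D_c>0$ and every $\tau>0$, $$\mathcal L^*_{\rm CT}(D_c,\tau)\ \ge\ \mathcal L^*_{\rm DT}(D_{d,\tau},\bar Q_{A,\tau},\tau)\ \ge\ \frac1\tau\,\theta^{-1}\big(R(D_{d,\tau},\bar Q_{A,\tau},\tau)\big).$$ -/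

import Mathlib

open MeasureTheory ProbabilityTheory Filter
open scoped ENNReal NNReal Matrix MatrixOrder

noncomputable section

namespace CausalCoding

/-! ### The function `θ` and its inverse -/

/-- `θ(x) = x + (1 + x) log₂ (1 + x) - x log₂ x` (with `0 log₂ 0 = 0`), meant for `x ≥ 0`. -/
def theta (x : ℝ) : ℝ :=
  x + (1 + x) * Real.logb 2 (1 + x) - x * Real.logb 2 x

/-- The inverse of `θ : [0, ∞) → [0, ∞)`. -/
def thetaInv (y : ℝ) : ℝ := Function.invFunOn theta (Set.Ici 0) y

/-- `θ⁻¹` on `[0, ∞]`, with the value `∞` at `∞`. -/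
def thetaInvExt (y : ℝ≥0∞) : ℝ≥0∞ :=
  if y = ∞ then ∞ else ENNReal.ofReal (thetaInv y.toReal)

/-! ### Packets, causal policies and the joint law they induce -/

/-- Packets: the finite binary strings, including the empty one. -/
def Packet : Type := List Bool

/-- The packets form a countable set with the discrete σ-algebra. -/
instance : MeasurableSpace Packet := ⊤

/-- The length of a packet. -/
def Packet.length (a : Packet) : ℕ := List.length a

/-- A causal policy: Markov kernels giving the law of the letter `y(k)`
conditionally on `y(0 : k-1)` and `x(0 : k)`. With `Y = Packet` this is an encoding policy,
with `Y = E` a reconstruction policy. -/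
structure CausalPolicy (E Y : Type*) [MeasurableSpace E] [MeasurableSpace Y] where
  /-- The kernel used at step `k`. -/
  kernel : (k : ℕ) → Kernel ((Fin k → Y) × (Fin (k + 1) → E)) Y
  isMarkov : ∀ k, IsMarkovKernel (kernel k)

variable {Ω E Y : Type*} [MeasurableSpace Ω] [MeasurableSpace E] [MeasurableSpace Y]

/-- The joint law of the source outcome `ω` (distributed as `P`) and of the first `K` letters
`y(0), …, y(K-1)` that the policy `π` produces from the sequence `x(0), x(1), …`: given `ω` and
`y(0 : k-1)`, the letter `y(k)` is drawn from the `k`-th kernel at `(y(0 : k-1), x(0 : k))`. -/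
def jointLaw (P : Measure Ω) (x : ℕ → Ω → E) (π : CausalPolicy E Y) :
    (K : ℕ) → Measure (Ω × (Fin K → Y))
  | 0 => P.map fun ω => (ω, Fin.elim0)
  | K + 1 => (jointLaw P x π K).bind fun p =>
      (π.kernel K (p.2, fun i => x i p.1)).map
        fun y => (p.1, (Fin.snoc p.2 y : Fin (K + 1) → Y))

/-- The expected length `𝔼[ℓ(a(k))]` of the `k`-th packet. -/
def expectedLength (P : Measure Ω) (x : ℕ → Ω → E) (π : CausalPolicy E Packet) (k : ℕ) : ℝ≥0∞ :=
  ∫⁻ p, ((p.2 (Fin.last k)).length : ℝ≥0∞) ∂(jointLaw P x π (k + 1))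

/-- The bitrate (bits per second) `limsup_K (1 / (K τ)) ∑_{k < K} 𝔼[ℓ(a(k))]`. -/
def bitrate (P : Measure Ω) (x : ℕ → Ω → E) (τ : ℝ≥0) (π : CausalPolicy E Packet) : ℝ≥0∞ :=
  limsup (fun K : ℕ => (∑ k ∈ Finset.range K, expectedLength P x π k) / ((K : ℝ≥0∞) * τ)) atTop

/-- The mutual information, in bits, of the two components of a pair with joint law `ν`. -/
def mutualInfo {S T : Type*} [MeasurableSpace S] [MeasurableSpace T] (ν : Measure (S × T)) :
    ℝ≥0∞ :=
  InformationTheory.klDiv ν (ν.fst.prod ν.snd) / ENNReal.ofReal (Real.log 2)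

/-- `ℝⁿ` with the Euclidean norm. -/
abbrev Vec (n : ℕ) : Type := EuclideanSpace ℝ (Fin n)

variable {n : ℕ}

/-- The minimum mean square error estimate `𝔼[Z | a(0 : k)]` of a function `Z` of the source. -/
def estimate (P : Measure Ω) (x : ℕ → Ω → Vec n) (π : CausalPolicy (Vec n) Packet) (k : ℕ)
    (Z : Ω → Vec n) : Ω × (Fin (k + 1) → Packet) → Vec n :=
  condExp (MeasurableSpace.comap Prod.snd inferInstance) (jointLaw P x π (k + 1))
    (fun p => Z p.1)

/-- `‖v‖²_Q = vᵀ Q v`, for `Q` positive semidefinite. -/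
def weightedSq (Q : Matrix (Fin n) (Fin n) ℝ) (v : Vec n) : ℝ≥0∞ :=
  ENNReal.ofReal (v.ofLp ⬝ᵥ Q *ᵥ v.ofLp)

/-! ### The continuous-time source and problem -/

/-- Hurwitz stability: all the (complex) eigenvalues have negative real part. -/
def IsHurwitz (A : Matrix (Fin n) (Fin n) ℝ) : Prop :=
  ∀ z ∈ spectrum ℂ (A.map (algebraMap ℝ ℂ)), z.re < 0

/-- `W` is a standard Brownian motion in `ℝⁿ`: its coordinates are independent standard real
Brownian motions. -/
structure IsStdBrownian (P : Measure Ω) (W : ℝ≥0 → Ω → Vec n) : Prop where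
  measurable : ∀ t, Measurable (W t)
  brownian : ∀ i, IsBrownianReal (fun t ω => W t ω i) P
  indep : iIndepFun (fun i ω (t : ℝ≥0) => W t ω i) P

/-- `X` solves `dX_t = A X_t dt + B dW_t`, `X_0 ∼ 𝒩(0, S₀)`, where `W` is a standard Brownian
motion that is independent of `X_0`. As the noise is additive, the equation in integrated form is
`X_t = X_0 + ∫_0^t A X_s ds + B W_t`. -/
structure IsSolution (P : Measure Ω) (A B S₀ : Matrix (Fin n) (Fin n) ℝ)
    (W X : ℝ≥0 → Ω → Vec n) : Prop where
  brownian : IsStdBrownian P W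
  measurable : ∀ t, Measurable (X t)
  initial : P.map (X 0) = multivariateGaussian 0 S₀
  indep : IndepFun (X 0) (fun ω (t : ℝ≥0) => W t ω) P
  continuous : ∀ᵐ ω ∂P, Continuous fun t => X t ω
  equation : ∀ᵐ ω ∂P, ∀ t : ℝ≥0,
    X t ω = X 0 ω
      + (∫ s in (0 : ℝ)..t, Matrix.toEuclideanCLM (𝕜 := ℝ) A (X s.toNNReal ω))
      + Matrix.toEuclideanCLM (𝕜 := ℝ) B (W t ω)

/-- The samples `x(k) = X_{kτ}`. -/
def samples (X : ℝ≥0 → Ω → Vec n) (τ : ℝ≥0) (k : ℕ) : Ω → Vec n := X (k * τ)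

/-- `𝔼 ‖X_t - X̂_t‖²` with `X̂_t = 𝔼[X_t | a(0 : ⌊t / τ⌋)]`. -/
def ctError (P : Measure Ω) (X : ℝ≥0 → Ω → Vec n) (τ : ℝ≥0) (π : CausalPolicy (Vec n) Packet)
    (t : ℝ≥0) : ℝ≥0∞ :=
  ∫⁻ p, ‖X t p.1 - estimate P (samples X τ) π ⌊t / τ⌋₊ (X t) p‖ₑ ^ 2
    ∂(jointLaw P (samples X τ) π (⌊t / τ⌋₊ + 1))

/-- `limsup_T (1 / T) ∫_0^T 𝔼 ‖X_t - X̂_t‖² dt`. -/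
def ctDistortion (P : Measure Ω) (X : ℝ≥0 → Ω → Vec n) (τ : ℝ≥0)
    (π : CausalPolicy (Vec n) Packet) : ℝ≥0∞ :=
  limsup (fun T : ℝ =>
    (∫⁻ t in Set.Ioc 0 T, ctError P X τ π t.toNNReal) / ENNReal.ofReal T) atTop

/-- The continuous-time minimum bitrate: the infimum of the bitrate over the causal encoding
policies that meet the continuous-time distortion constraint (`∞` if there is none). -/
def minBitrateCT (P : Measure Ω) (X : ℝ≥0 → Ω → Vec n) (D : ℝ) (τ : ℝ≥0) : ℝ≥0∞ :=
  ⨅ (π : CausalPolicy (Vec n) Packet) (_ : (ctDistortion P X τ π : EReal) ≤ (D : EReal)),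
    bitrate P (samples X τ) τ π

/-! ### The discrete-time source and problems -/

/-- `A_s = exp (s A)`. -/
def expA (A : Matrix (Fin n) (Fin n) ℝ) (s : ℝ) : Matrix (Fin n) (Fin n) ℝ :=
  NormedSpace.exp (s • A)

/-- `∫_0^s e^{Aλ} B Bᵀ e^{Aᵀλ} dλ`, entry by entry. -/
def noiseCov (A B : Matrix (Fin n) (Fin n) ℝ) (s : ℝ) : Matrix (Fin n) (Fin n) ℝ :=
  Matrix.of fun i j => ∫ r in (0 : ℝ)..s, (expA A r * B * Bᵀ * expA Aᵀ r) i j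

/-- `B_s`, the positive semidefinite square root of `∫_0^s e^{Aλ} B Bᵀ e^{Aᵀλ} dλ`. -/
def noiseRoot (A B : Matrix (Fin n) (Fin n) ℝ) (s : ℝ) : Matrix (Fin n) (Fin n) ℝ :=
  CFC.sqrt (noiseCov A B s)

/-- `Q̄_{A,τ} = ∫_0^τ e^{Aᵀt} e^{At} dt`, entry by entry. -/
def Qbar (A : Matrix (Fin n) (Fin n) ℝ) (τ : ℝ) : Matrix (Fin n) (Fin n) ℝ :=
  Matrix.of fun i j => ∫ t in (0 : ℝ)..τ, (expA Aᵀ t * expA A t) i j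

/-- `b̄_τ = Tr ∫_0^τ B_t B_tᵀ dt`. -/
def bBar (A B : Matrix (Fin n) (Fin n) ℝ) (τ : ℝ) : ℝ :=
  (Matrix.of fun i j => ∫ t in (0 : ℝ)..τ, (noiseRoot A B t * (noiseRoot A B t)ᵀ) i j :
    Matrix (Fin n) (Fin n) ℝ).trace

/-- The law of the initial state `x(0) ∼ 𝒩(0, S₀)` and of the noise `w(0), w(1), …`, which is
i.i.d. standard Gaussian and independent of `x(0)`. -/
def dtSource (S₀ : Matrix (Fin n) (Fin n) ℝ) : Measure (Vec n × (ℕ → Vec n)) :=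
  (multivariateGaussian 0 S₀).prod (Measure.infinitePi fun _ : ℕ => stdGaussian (Vec n))

/-- The discrete-time dynamics `x(k+1) = A_τ x(k) + B_τ w(k)`. -/
def dtState (A B : Matrix (Fin n) (Fin n) ℝ) (τ : ℝ) : ℕ → Vec n × (ℕ → Vec n) → Vec n
  | 0, p => p.1
  | k + 1, p => Matrix.toEuclideanCLM (𝕜 := ℝ) (expA A τ) (dtState A B τ k p)
      + Matrix.toEuclideanCLM (𝕜 := ℝ) (noiseRoot A B τ) (p.2 k)

/-- `limsup_K (1 / K) ∑_{k < K} 𝔼 ‖x(k) - x̂(k)‖²_Q` for an encoding policy, with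
`x̂(k) = 𝔼[x(k) | a(0 : k)]`. -/
def dtDistortion (A B S₀ Q : Matrix (Fin n) (Fin n) ℝ) (τ : ℝ≥0)
    (π : CausalPolicy (Vec n) Packet) : ℝ≥0∞ :=
  limsup (fun K : ℕ => (∑ k ∈ Finset.range K,
    ∫⁻ p, weightedSq Q (dtState A B τ k p.1
        - estimate (dtSource S₀) (dtState A B τ) π k (dtState A B τ k) p)
      ∂(jointLaw (dtSource S₀) (dtState A B τ) π (k + 1))) / (K : ℝ≥0∞)) atTop

/-- The discrete-time minimum bitrate with distortion `D` and weight `Q`: the infimum of the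
bitrate over the causal encoding policies that meet the constraint (`∞` if there is none). -/
def minBitrateDT (A B S₀ : Matrix (Fin n) (Fin n) ℝ) (D : ℝ) (Q : Matrix (Fin n) (Fin n) ℝ)
    (τ : ℝ≥0) : ℝ≥0∞ :=
  ⨅ (π : CausalPolicy (Vec n) Packet) (_ : (dtDistortion A B S₀ Q τ π : EReal) ≤ (D : EReal)),
    bitrate (dtSource S₀) (dtState A B τ) τ π

/-- `limsup_K (1 / K) ∑_{k < K} 𝔼 ‖x(k) - x̂(k)‖²_Q` for a reconstruction policy, which draws
`x̂(k)` itself. -/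
def reconDistortion (A B S₀ Q : Matrix (Fin n) (Fin n) ℝ) (τ : ℝ≥0)
    (π : CausalPolicy (Vec n) (Vec n)) : ℝ≥0∞ :=
  limsup (fun K : ℕ => (∑ k ∈ Finset.range K,
    ∫⁻ p, weightedSq Q (dtState A B τ k p.1 - p.2 (Fin.last k))
      ∂(jointLaw (dtSource S₀) (dtState A B τ) π (k + 1))) / (K : ℝ≥0∞)) atTop

/-- `limsup_K (1 / K) I(x(0 : K-1); x̂(0 : K-1))` for a reconstruction policy. -/
def infoRate (A B S₀ : Matrix (Fin n) (Fin n) ℝ) (τ : ℝ≥0)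
    (π : CausalPolicy (Vec n) (Vec n)) : ℝ≥0∞ :=
  limsup (fun K : ℕ =>
    mutualInfo ((jointLaw (dtSource S₀) (dtState A B τ) π K).map
      fun p => ((fun i : Fin K => dtState A B τ i p.1), p.2)) / (K : ℝ≥0∞)) atTop

/-- The discrete-time causal rate-distortion function `R(D, Q, τ)`: the infimum of the information
rate over the causal reconstruction policies that meet the constraint (`∞` if there is none). -/
def causalRDF (A B S₀ : Matrix (Fin n) (Fin n) ℝ) (D : ℝ) (Q : Matrix (Fin n) (Fin n) ℝ)
    (τ : ℝ≥0) : ℝ≥0∞ :=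
  ⨅ (π : CausalPolicy (Vec n) (Vec n)) (_ : (reconDistortion A B S₀ Q τ π : EReal) ≤ (D : EReal)),
    infoRate A B S₀ τ π

end CausalCoding

end

open CausalCoding

noncomputable section

namespace CausalCoding

/-! ### The function `θ` -/

/-! Continuous versus discrete time. Put `s = t - kτ` with `0 ≤ s < τ`. Then `x_t = e^{As} x(k) +
N`, where the noise `N` accumulated since `kτ` is centred Gaussian with covariance `noiseCov A B s`
and independent of the samples and packets up to `k`. Hence the estimate between samples is `e^{As}
x̂(k)`, and the error splits orthogonally into `E‖e^{As}(x(k) - x̂(k))‖²` and the trace of the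
covariance (`IsSolution.ctError_eq`). Integrated over one period, these become the `Q̄`-weighted
error at the sampling time and the constant `b̄_τ`. Sampling the distortion limsup at `T = Kτ`
therefore turns the continuous constraint into the discrete one. The samples have the law of the
discrete source (`IsSolution.map_samples`), so the same kernels give the same bitrate and error in
both problems, and the first inequality is an inclusion of feasible sets.

The Gaussian law and the independence of `N` come without stochastic integration. Along each path,
`N` is a limit of Euler sums in the increments of `W` (`tendsto_eulerSum`). Their characteristic
functions are explicit and converge through Riemann sums, and independence survives almost sure
limits.

Rate versus information. Decoding each packet history to its estimate gives a law of symbols and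
reconstructions which some causal reconstruction policy reproduces (`jointLaw_reconPolicy`), so `R`
is at most its information rate. The information is at most the entropy of the reconstructions,
hence at most the cross entropy of the packets against any reference law. The reference is a product
of geometric lengths of mean `M` with uniform bits, for which `-log₂ q(a)` is affine in the length:
per packet it is the tangent line of `θ` at `M`. If the mean total length of `K` packets is at most
`KM`, the information is at most `Kθ(M)` (`mutualInfo_map_le`). Taking `M = cτ` for every `c` above
the bitrate and inverting `θ` gives the second inequality. As the tangent line is used directly,
neither Jensen's inequality nor entropy maximisation is needed. -/

/-- In terms of `Real.negMulLog` the convention `0 log 0 = 0` is built in, so continuity at `0`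
needs no separate argument. -/
lemma theta_eq (x : ℝ) :
    theta x = x + (Real.negMulLog x - Real.negMulLog (1 + x)) / Real.log 2 := by
  simp only [theta, Real.logb, Real.negMulLog]
  ring

lemma continuous_theta : Continuous theta := by
  have : theta = fun x => x + (Real.negMulLog x - Real.negMulLog (1 + x)) / Real.log 2 :=
    funext theta_eq
  rw [this]
  have h := Real.continuous_negMulLog
  fun_prop

@[simp]
lemma theta_zero : theta 0 = 0 := by simp [theta]

lemma hasDerivAt_theta {x : ℝ} (hx : 0 < x) :
    HasDerivAt theta (1 + (Real.log (1 + x) - Real.log x) / Real.log 2) x := by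
  have h1 : HasDerivAt Real.negMulLog (-Real.log x - 1) x := Real.hasDerivAt_negMulLog hx.ne'
  have h2 : HasDerivAt (fun y => Real.negMulLog (1 + y)) (-Real.log (1 + x) - 1) x := by
    have := (Real.hasDerivAt_negMulLog (x := 1 + x) (by positivity)).comp_const_add 1 x
    simpa using this
  rw [show theta = fun x => x + (Real.negMulLog x - Real.negMulLog (1 + x)) / Real.log 2 from
    funext theta_eq]
  exact ((hasDerivAt_id x).add ((h1.sub h2).div_const (Real.log 2))).congr_deriv (by ring)

lemma deriv_theta {x : ℝ} (hx : 0 < x) :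
    deriv theta x = 1 + (Real.log (1 + x) - Real.log x) / Real.log 2 :=
  (hasDerivAt_theta hx).deriv

lemma one_le_deriv_theta {x : ℝ} (hx : 0 < x) : 1 ≤ deriv theta x := by
  rw [deriv_theta hx]
  have h1 : Real.log x ≤ Real.log (1 + x) := Real.log_le_log hx (by linarith)
  have h2 : 0 < Real.log 2 := Real.log_pos one_lt_two
  have : 0 ≤ (Real.log (1 + x) - Real.log x) / Real.log 2 := div_nonneg (by linarith) h2.le
  linarith

lemma strictMonoOn_theta : StrictMonoOn theta (Set.Ici 0) := by
  refine strictMonoOn_of_deriv_pos (convex_Ici 0) continuous_theta.continuousOn fun x hx => ?_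
  rw [interior_Ici] at hx
  linarith [one_le_deriv_theta hx]

lemma concaveOn_theta : ConcaveOn ℝ (Set.Ici 0) theta := by
  refine AntitoneOn.concaveOn_of_deriv (convex_Ici 0) continuous_theta.continuousOn ?_ ?_
  · intro x hx
    rw [interior_Ici] at hx
    exact (hasDerivAt_theta hx).differentiableAt.differentiableWithinAt
  · intro x hx y hy hxy
    rw [interior_Ici] at hx hy
    rw [deriv_theta hx, deriv_theta hy]
    have h2 : 0 < Real.log 2 := Real.log_pos one_lt_two
    simp only [Set.mem_Ioi] at hx hy
    have h3 : Real.log (1 + y) - Real.log y ≤ Real.log (1 + x) - Real.log x := by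
      rw [← Real.log_div (by positivity) (by positivity),
        ← Real.log_div (by positivity) (by positivity)]
      refine Real.log_le_log (by positivity) ?_
      rw [div_le_div_iff₀ hy hx]
      nlinarith
    gcongr

/-- Used for surjectivity: the value `y` is already attained on `[0, y]`, so no limit at infinity
has to be computed. -/
lemma self_le_theta {x : ℝ} (hx : 0 ≤ x) : x ≤ theta x := by
  rcases hx.eq_or_lt with rfl | hx
  · simp
  have h1 : Real.log x ≤ Real.log (1 + x) := Real.log_le_log hx (by linarith)
  have h0 : 0 ≤ Real.log (1 + x) := Real.log_nonneg (by linarith)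
  have h2 : 0 < Real.log 2 := Real.log_pos one_lt_two
  have : 0 ≤ (Real.negMulLog x - Real.negMulLog (1 + x)) / Real.log 2 := by
    refine div_nonneg ?_ h2.le
    simp only [Real.negMulLog]
    nlinarith
  rw [theta_eq]
  linarith

lemma bijOn_theta : Set.BijOn theta (Set.Ici 0) (Set.Ici 0) := by
  refine ⟨fun x hx => le_trans hx (self_le_theta hx), strictMonoOn_theta.injOn, fun y hy => ?_⟩
  have h := intermediate_value_Icc (f := theta) (show (0 : ℝ) ≤ y from hy)
    continuous_theta.continuousOn
  obtain ⟨x, hx, rfl⟩ := h ⟨by simpa using hy, self_le_theta hy⟩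
  exact ⟨x, hx.1, rfl⟩

/-- The Galois-type property of `θ⁻¹` used for the converse bound. -/
lemma thetaInvExt_le_ofReal {y : ℝ≥0∞} {M : ℝ} (hM : 0 ≤ M)
    (h : y ≤ ENNReal.ofReal (theta M)) : thetaInvExt y ≤ ENNReal.ofReal M := by
  have hy : y ≠ ∞ := ne_top_of_le_ne_top ENNReal.ofReal_ne_top h
  rw [thetaInvExt, if_neg hy]
  refine ENNReal.ofReal_le_ofReal ?_
  have hy0 : y.toReal ∈ Set.Ici (0 : ℝ) := ENNReal.toReal_nonneg
  have hmem : thetaInv y.toReal ∈ Set.Ici (0 : ℝ) := bijOn_theta.surjOn.mapsTo_invFunOn hy0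
  have heq : theta (thetaInv y.toReal) = y.toReal := bijOn_theta.surjOn.rightInvOn_invFunOn hy0
  refine (strictMonoOn_theta.le_iff_le hmem hM).1 ?_
  rw [heq]
  exact ENNReal.toReal_le_of_le_ofReal (le_trans hM (self_le_theta hM)) h

/-! ### The kernel generated by a causal policy -/

section PolicyKernel

variable {Ω Ω' E Y F : Type*} [MeasurableSpace Ω] [MeasurableSpace Ω'] [MeasurableSpace E]
  [MeasurableSpace Y] [MeasurableSpace F]

instance (π : CausalPolicy E Y) (k : ℕ) : IsMarkovKernel (π.kernel k) := π.isMarkov k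

lemma measurable_finSnoc {K : ℕ} :
    Measurable fun q : (Fin K → Y) × Y => (Fin.snoc q.1 q.2 : Fin (K + 1) → Y) := by
  refine measurable_pi_iff.2 fun i => ?_
  refine Fin.lastCases ?_ (fun j => ?_) i
  · simpa using measurable_snd
  · simp only [Fin.snoc_castSucc]
    fun_prop

lemma measurable_finInit {K : ℕ} :
    Measurable fun x : Fin (K + 1) → E => (Fin.init x : Fin K → E) :=
  measurable_pi_iff.2 fun _ => measurable_pi_apply _

/-- The law of the first `K` letters of a causal policy, given the first `K` source symbols. -/
def policyKernel (π : CausalPolicy E Y) : (K : ℕ) → Kernel (Fin K → E) (Fin K → Y)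
  | 0 => Kernel.const _ (Measure.dirac Fin.elim0)
  | K + 1 => (((policyKernel π K).comap Fin.init measurable_finInit) ⊗ₖ
      ((π.kernel K).comap Prod.swap measurable_swap)).map fun q => Fin.snoc q.1 q.2

instance (π : CausalPolicy E Y) : (K : ℕ) → IsMarkovKernel (policyKernel π K)
  | 0 => by rw [policyKernel]; infer_instance
  | K + 1 => by
    have := instIsMarkovKernelForallFinPolicyKernel π K
    rw [policyKernel]
    exact Kernel.IsMarkovKernel.map _ measurable_finSnoc

lemma lintegral_policyKernel_succ (π : CausalPolicy E Y) (K : ℕ) (x : Fin (K + 1) → E)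
    {f : (Fin (K + 1) → Y) → ℝ≥0∞} (hf : Measurable f) :
    ∫⁻ y, f y ∂policyKernel π (K + 1) x
      = ∫⁻ a, ∫⁻ y, f (Fin.snoc a y) ∂π.kernel K (a, x) ∂policyKernel π K (Fin.init x) := by
  rw [policyKernel, Kernel.lintegral_map _ measurable_finSnoc _ hf,
    Kernel.lintegral_compProd _ _ _ (show Measurable fun q : (Fin K → Y) × Y =>
      f (Fin.snoc q.1 q.2) from hf.comp measurable_finSnoc)]
  rfl

lemma measurable_finProcess {x : ℕ → Ω → E} (hx : ∀ i, Measurable (x i)) (K : ℕ) :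
    Measurable fun ω (i : Fin K) => x i ω := by fun_prop

lemma lintegral_jointLaw_succ (P : Measure Ω) {x : ℕ → Ω → E} (hx : ∀ i, Measurable (x i))
    (π : CausalPolicy E Y) (K : ℕ) {f : Ω × (Fin (K + 1) → Y) → ℝ≥0∞} (hf : Measurable f) :
    ∫⁻ p, f p ∂jointLaw P x π (K + 1)
      = ∫⁻ p, ∫⁻ y, f (p.1, Fin.snoc p.2 y) ∂π.kernel K (p.2, fun i => x i p.1)
          ∂jointLaw P x π K := by
  have hg : Measurable fun p : Ω × (Fin K → Y) => (p.2, fun i : Fin (K + 1) => x i p.1) := by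
    fun_prop
  have hs : Measurable fun q : (Ω × (Fin K → Y)) × Y =>
      (q.1.1, (Fin.snoc q.1.2 q.2 : Fin (K + 1) → Y)) :=
    measurable_fst.fst.prodMk
      (measurable_finSnoc.comp (measurable_fst.snd.prodMk measurable_snd))
  let κ : Kernel (Ω × (Fin K → Y)) (Ω × (Fin (K + 1) → Y)) :=
    (Kernel.id ×ₖ ((π.kernel K).comap _ hg)).map fun q : (Ω × (Fin K → Y)) × Y =>
      (q.1.1, (Fin.snoc q.1.2 q.2 : Fin (K + 1) → Y))
  have hs' (p : Ω × (Fin K → Y)) : Measurable fun y : Y =>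
      (p.1, (Fin.snoc p.2 y : Fin (K + 1) → Y)) :=
    measurable_const.prodMk (measurable_finSnoc.comp measurable_prodMk_left)
  -- Integrating against a `bind` requires measurability of the measure-valued integrand;
  -- recognising it as a kernel supplies this.
  have hκ : (fun p : Ω × (Fin K → Y) => (π.kernel K (p.2, fun i => x i p.1)).map
        fun y => (p.1, (Fin.snoc p.2 y : Fin (K + 1) → Y))) = κ := by
    ext p s hsm
    rw [Kernel.map_apply' _ hs _ hsm, Kernel.prod_apply, Kernel.id_apply,
      Measure.dirac_prod, Measure.map_apply measurable_prodMk_left (hs hsm),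
      Measure.map_apply (hs' p) hsm]
    rfl
  rw [jointLaw, Measure.lintegral_bind _ hf.aemeasurable]
  · refine lintegral_congr fun p => ?_
    rw [lintegral_map hf (hs' p)]
  · rw [hκ]
    exact κ.measurable.aemeasurable

/-- The letters see `ω` only through the first `K` symbols, so the joint law disintegrates over `P`
with a kernel pulled back along these symbols. Marginals, independence and invariance under a change
of probability space all follow from this form. -/
lemma jointLaw_eq_compProd (P : Measure Ω) [SFinite P] {x : ℕ → Ω → E}
    (hx : ∀ i, Measurable (x i)) (π : CausalPolicy E Y) (K : ℕ) :
    jointLaw P x π K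
      = P ⊗ₘ (policyKernel π K).comap _ (measurable_finProcess hx K) := by
  induction K with
  | zero =>
    refine Measure.ext_of_lintegral _ fun f hf => ?_
    rw [jointLaw, lintegral_map hf (by fun_prop), Measure.lintegral_compProd hf]
    refine lintegral_congr fun ω => ?_
    rw [Kernel.comap_apply, policyKernel, Kernel.const_apply, lintegral_dirac' _ (by fun_prop)]
  | succ K ih =>
    refine Measure.ext_of_lintegral _ fun f hf => ?_
    rw [lintegral_jointLaw_succ P hx π K hf, ih, Measure.lintegral_compProd,
      Measure.lintegral_compProd hf]
    · refine lintegral_congr fun ω => ?_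
      rw [Kernel.comap_apply, Kernel.comap_apply, lintegral_policyKernel_succ _ _ _ (by fun_prop)]
      rfl
    · have hg : Measurable fun p : Ω × (Fin K → Y) => (p.2, fun i : Fin (K + 1) => x i p.1) := by
        fun_prop
      exact Measurable.lintegral_kernel_prod_right' (κ := (π.kernel K).comap _ hg)
        (f := fun q => f (q.1.1, Fin.snoc q.1.2 q.2))
        (hf.comp (measurable_fst.fst.prodMk
      (measurable_finSnoc.comp (measurable_fst.snd.prodMk measurable_snd))))

lemma isProbabilityMeasure_jointLaw (P : Measure Ω) [IsProbabilityMeasure P] {x : ℕ → Ω → E}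
    (hx : ∀ i, Measurable (x i)) (π : CausalPolicy E Y) (K : ℕ) :
    IsProbabilityMeasure (jointLaw P x π K) := by
  rw [jointLaw_eq_compProd P hx]
  infer_instance

lemma map_compProd_comap (P : Measure Ω) [SFinite P] {g : Ω → E} (hg : Measurable g)
    (κ : Kernel E Y) [IsSFiniteKernel κ] :
    (P ⊗ₘ κ.comap g hg).map (Prod.map g id) = (P.map g) ⊗ₘ κ := by
  refine Measure.ext_of_lintegral _ fun f hf => ?_
  rw [lintegral_map hf (by fun_prop), Measure.lintegral_compProd (by fun_prop),
    Measure.lintegral_compProd hf, lintegral_map _ hg]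
  · rfl
  · exact hf.lintegral_kernel_prod_right'

/-- The joint law of the first `K` source symbols and the first `K` letters. -/
lemma jointLaw_map (P : Measure Ω) [SFinite P] {x : ℕ → Ω → E}
    (hx : ∀ i, Measurable (x i)) (π : CausalPolicy E Y) (K : ℕ) :
    (jointLaw P x π K).map (fun p => ((fun i : Fin K => x i p.1), p.2))
      = (P.map fun ω (i : Fin K) => x i ω) ⊗ₘ policyKernel π K := by
  rw [jointLaw_eq_compProd P hx, ← map_compProd_comap P (measurable_finProcess hx K)]
  rfl

lemma jointLaw_map_fst (P : Measure Ω) [SFinite P] {x : ℕ → Ω → E}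
    (hx : ∀ i, Measurable (x i)) (π : CausalPolicy E Y) (K : ℕ) :
    (jointLaw P x π K).map Prod.fst = P := by
  rw [jointLaw_eq_compProd P hx]
  exact Measure.fst_compProd _ _

/-- Given the source symbols, the letters are independent of everything else. -/
lemma indepFun_jointLaw (P : Measure Ω) [IsProbabilityMeasure P] {x : ℕ → Ω → E}
    (hx : ∀ i, Measurable (x i)) (π : CausalPolicy E Y) (K : ℕ) {f : Ω → F} (hf : Measurable f)
    (h : IndepFun f (fun ω (i : Fin K) => x i ω) P) :
    IndepFun (fun p => f p.1) (fun p => ((fun i : Fin K => x i p.1), p.2))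
      (jointLaw P x π K) := by
  have := isProbabilityMeasure_jointLaw P hx π K
  have hxm := measurable_finProcess hx K
  have hfx := (indepFun_iff_map_prod_eq_prod_map_map hf.aemeasurable hxm.aemeasurable).1 h
  rw [indepFun_iff_map_prod_eq_prod_map_map (by fun_prop) (by fun_prop), jointLaw_map P hx]
  have h1 : (jointLaw P x π K).map (fun p => f p.1) = P.map f := by
    rw [← Function.comp_def, ← Measure.map_map hf measurable_fst, jointLaw_map_fst P hx]
  rw [h1, jointLaw_eq_compProd P hx]
  have : IsProbabilityMeasure (P.map f) := Measure.isProbabilityMeasure_map hf.aemeasurable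
  have : IsProbabilityMeasure (P.map fun ω (i : Fin K) => x i ω) :=
    Measure.isProbabilityMeasure_map hxm.aemeasurable
  refine Measure.ext_of_lintegral _ fun g hg => ?_
  rw [lintegral_map hg (by fun_prop), Measure.lintegral_compProd (by fun_prop),
    lintegral_prod _ hg.aemeasurable]
  have h2 : ∀ a : F, ∫⁻ q, g (a, q) ∂((P.map fun ω (i : Fin K) => x i ω) ⊗ₘ policyKernel π K)
      = ∫⁻ u, ∫⁻ y, g (a, (u, y)) ∂policyKernel π K u ∂(P.map fun ω (i : Fin K) => x i ω) :=
    fun a => Measure.lintegral_compProd (by fun_prop)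
  simp_rw [h2]
  have hG : Measurable fun q : F × (Fin K → E) =>
      ∫⁻ y, g (q.1, (q.2, y)) ∂policyKernel π K q.2 :=
    Measurable.lintegral_kernel_prod_right'
      (κ := (policyKernel π K).comap (Prod.snd : F × (Fin K → E) → _) measurable_snd)
      (f := fun r => g (r.1.1, (r.1.2, r.2))) (by fun_prop)
  rw [← lintegral_prod (fun q : F × (Fin K → E) => ∫⁻ y, g (q.1, (q.2, y)) ∂policyKernel π K q.2)
    hG.aemeasurable, ← hfx, lintegral_map hG (by fun_prop)]
  rfl

/-- This lets one policy be moved from the samples of the diffusion to the discrete-time model. -/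
lemma jointLaw_congr_law {P : Measure Ω} {P' : Measure Ω'} [SFinite P] [SFinite P']
    {x : ℕ → Ω → E} {x' : ℕ → Ω' → E} (hx : ∀ i, Measurable (x i)) (hx' : ∀ i, Measurable (x' i))
    (π : CausalPolicy E Y) {K : ℕ}
    (h : (P.map fun ω (i : Fin K) => x i ω) = P'.map fun ω (i : Fin K) => x' i ω) :
    (jointLaw P x π K).map (fun p => ((fun i : Fin K => x i p.1), p.2))
      = (jointLaw P' x' π K).map (fun p => ((fun i : Fin K => x' i p.1), p.2)) := by
  rw [jointLaw_map P hx, jointLaw_map P' hx', h]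

end PolicyKernel

/-! ### Conditional expectations and estimates -/

section Estimate

variable {Ω Ω' : Type*} [mΩ : MeasurableSpace Ω] [MeasurableSpace Ω'] {n : ℕ}

/-- Sets of the pulled-back σ-algebra are preimages, and the change of variables formula matches the
integrals over them. -/
lemma condExp_comp_of_map {α β G : Type*} {mα : MeasurableSpace α} {m mβ : MeasurableSpace β}
    [NormedAddCommGroup G] [NormedSpace ℝ G] [CompleteSpace G]
    {μ : Measure α} [IsFiniteMeasure μ] {φ : α → β} (hφ : Measurable φ)
    (hm : m ≤ mβ) {f : β → G} (hf : Integrable f (μ.map φ)) :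
    μ[f ∘ φ | m.comap φ] =ᵐ[μ] (μ.map φ)[f | m] ∘ φ := by
  have hle : m.comap φ ≤ mα := (MeasurableSpace.comap_mono hm).trans hφ.comap_le
  symm
  refine ae_eq_condExp_of_forall_setIntegral_eq hle (hf.comp_measurable hφ) ?_ ?_ ?_
  · intro s _ _
    exact (integrable_condExp.comp_measurable hφ).integrableOn
  · rintro s ⟨t, ht, rfl⟩ _
    have h1 := setIntegral_map (f := (μ.map φ)[f | m]) (hm t ht)
      integrable_condExp.aestronglyMeasurable hφ.aemeasurable
    have h2 := setIntegral_map (f := f) (hm t ht) hf.aestronglyMeasurable hφ.aemeasurable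
    simp only [Function.comp_apply]
    rw [← h1, ← h2]
    exact setIntegral_condExp hm hf ht
  · refine StronglyMeasurable.aestronglyMeasurable ?_
    exact stronglyMeasurable_condExp.comp_measurable (measurable_iff_comap_le.2 le_rfl)

/-- The estimate of the last symbol, as a function of the symbols and the packets. -/
def lastEstimate {k : ℕ} (μ : Measure ((Fin (k + 1) → Vec n) × (Fin (k + 1) → Packet))) :
    (Fin (k + 1) → Vec n) × (Fin (k + 1) → Packet) → Vec n :=
  condExp (MeasurableSpace.comap Prod.snd inferInstance) μ fun q => q.1 (Fin.last k)

/-- Both the estimated symbol and the conditioning σ-algebra factor through the pair (symbols,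
packets), so the estimate can be computed under the law of that pair. -/
lemma estimate_ae_eq_lastEstimate (P : Measure Ω) [IsProbabilityMeasure P] {x : ℕ → Ω → Vec n}
    (hx : ∀ i, Measurable (x i)) (π : CausalPolicy (Vec n) Packet) (k : ℕ)
    (hint : Integrable (x k) P) :
    estimate P x π k (x k) =ᵐ[jointLaw P x π (k + 1)]
      lastEstimate ((jointLaw P x π (k + 1)).map
        (fun p => ((fun i : Fin (k + 1) => x i p.1), p.2))) ∘
      (fun p => ((fun i : Fin (k + 1) => x i p.1), p.2)) := by
  have := isProbabilityMeasure_jointLaw P hx π (k + 1)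
  have hφ : Measurable fun p : Ω × (Fin (k + 1) → Packet) =>
    ((fun i : Fin (k + 1) => x i p.1), p.2) := by fun_prop
  have h := condExp_comp_of_map (μ := jointLaw P x π (k + 1)) hφ
    (m := MeasurableSpace.comap Prod.snd inferInstance) measurable_snd.comap_le
    (f := fun q : (Fin (k + 1) → Vec n) × (Fin (k + 1) → Packet) => q.1 (Fin.last k)) ?_
  · rw [MeasurableSpace.comap_comp] at h
    exact h
  · rw [integrable_map_measure (by fun_prop) hφ.aemeasurable]
    have : Integrable (fun p : Ω × (Fin (k + 1) → Packet) => x k p.1)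
        (jointLaw P x π (k + 1)) := by
      have h2 : Integrable (x k) ((jointLaw P x π (k + 1)).map Prod.fst) := by
        rwa [jointLaw_map_fst P hx]
      exact h2.comp_measurable measurable_fst
    exact this

lemma measurable_weightedSq (Q : Matrix (Fin n) (Fin n) ℝ) : Measurable (weightedSq Q) := by
  have : Continuous fun v : Vec n => v.ofLp ⬝ᵥ Q *ᵥ v.ofLp := by
    have h : Continuous fun v : Vec n => v.ofLp := PiLp.continuous_ofLp _ _
    exact h.dotProduct (continuous_const.matrix_mulVec h)
  exact this.measurable.ennreal_ofReal

lemma measurable_lastEstimate {k : ℕ}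
    (μ : Measure ((Fin (k + 1) → Vec n) × (Fin (k + 1) → Packet))) :
    Measurable (lastEstimate μ) :=
  (stronglyMeasurable_condExp.mono measurable_snd.comap_le).measurable

/-- The error of the estimate of the last symbol depends only on the law of the symbols and
the packets. -/
lemma lintegral_error_estimate (P : Measure Ω) [IsProbabilityMeasure P] {x : ℕ → Ω → Vec n}
    (hx : ∀ i, Measurable (x i)) (π : CausalPolicy (Vec n) Packet) (k : ℕ)
    (hint : Integrable (x k) P) {w : Vec n → ℝ≥0∞} (hw : Measurable w) :
    ∫⁻ p, w (x k p.1 - estimate P x π k (x k) p) ∂jointLaw P x π (k + 1)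
      = ∫⁻ q, w (q.1 (Fin.last k) - lastEstimate ((jointLaw P x π (k + 1)).map
          (fun p => ((fun i : Fin (k + 1) => x i p.1), p.2))) q)
        ∂(jointLaw P x π (k + 1)).map (fun p => ((fun i : Fin (k + 1) => x i p.1), p.2)) := by
  have hφ : Measurable fun p : Ω × (Fin (k + 1) → Packet) =>
    ((fun i : Fin (k + 1) => x i p.1), p.2) := by fun_prop
  have hL := measurable_lastEstimate ((jointLaw P x π (k + 1)).map
    (fun p => ((fun i : Fin (k + 1) => x i p.1), p.2)))
  rw [lintegral_map (by fun_prop) hφ]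
  refine lintegral_congr_ae ?_
  filter_upwards [estimate_ae_eq_lastEstimate P hx π k hint] with p hp
  rw [hp]
  rfl

lemma measurable_packetLength : Measurable fun a : Packet => (a.length : ℝ≥0∞) :=
  fun _ _ => trivial

lemma expectedLength_eq (P : Measure Ω) {x : ℕ → Ω → Vec n}
    (hx : ∀ i, Measurable (x i)) (π : CausalPolicy (Vec n) Packet) (k : ℕ) :
    expectedLength P x π k = ∫⁻ q, ((q.2 (Fin.last k)).length : ℝ≥0∞)
      ∂(jointLaw P x π (k + 1)).map (fun p => ((fun i : Fin (k + 1) => x i p.1), p.2)) := by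
  have := measurable_packetLength
  rw [lintegral_map (by fun_prop) (by fun_prop)]
  rfl

lemma bitrate_congr_law {P : Measure Ω} {P' : Measure Ω'} [SFinite P] [SFinite P']
    {x : ℕ → Ω → Vec n} {x' : ℕ → Ω' → Vec n} (hx : ∀ i, Measurable (x i))
    (hx' : ∀ i, Measurable (x' i))
    (h : ∀ K, (P.map fun ω (i : Fin K) => x i ω) = P'.map fun ω (i : Fin K) => x' i ω)
    (τ : ℝ≥0) (π : CausalPolicy (Vec n) Packet) :
    bitrate P x τ π = bitrate P' x' τ π := by
  have hk : ∀ k, expectedLength P x π k = expectedLength P' x' π k := fun k => by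
    rw [expectedLength_eq P hx, expectedLength_eq P' hx', jointLaw_congr_law hx hx' π (h (k + 1))]
  simp only [bitrate, hk]

end Estimate

/-! ### Mutual information with a discrete variable -/

section Information

open InformationTheory

/-- If `μ` has density at most `g ≥ 1` with respect to `ν`, then its divergence from `ν` is at
most the `μ`-mean of `log g`. -/
lemma klDiv_le_lintegral_log {α : Type*} [MeasurableSpace α] {μ ν : Measure α}
    [IsProbabilityMeasure μ] [IsProbabilityMeasure ν] {g : α → ℝ} (hg : Measurable g)
    (hg1 : ∀ x, 1 ≤ g x) (h : μ ≤ ν.withDensity fun x => ENNReal.ofReal (g x)) :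
    klDiv μ ν ≤ ∫⁻ x, ENNReal.ofReal (Real.log (g x)) ∂μ := by
  have hac : μ ≪ ν :=
    (Measure.absolutelyContinuous_of_le h).trans (withDensity_absolutelyContinuous _ _)
  have hwd : ν.withDensity (μ.rnDeriv ν) = μ := Measure.withDensity_rnDeriv_eq _ _ hac
  have hle : μ.rnDeriv ν ≤ᵐ[ν] fun x => ENNReal.ofReal (g x) := by
    refine ae_le_of_forall_setLIntegral_le_of_sigmaFinite (Measure.measurable_rnDeriv _ _)
      fun s hs _ => ?_
    rw [← withDensity_apply _ hs, ← withDensity_apply _ hs, hwd]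
    exact h s
  -- With `f = dμ/dν`, `klFun f = f log f + 1 - f`. Moving `f` to the left avoids subtraction in
  -- `ℝ≥0∞`; after integration it contributes mass `1` on one side and the constant contributes `1`
  -- on the other, and these cancel.
  have hpt : ∀ᵐ x ∂ν, ENNReal.ofReal (klFun (μ.rnDeriv ν x).toReal) + μ.rnDeriv ν x
      ≤ μ.rnDeriv ν x * ENNReal.ofReal (Real.log (g x)) + 1 := by
    filter_upwards [hle, Measure.rnDeriv_ne_top μ ν] with x hx hx'
    have hg0 : 0 ≤ Real.log (g x) := Real.log_nonneg (hg1 x)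
    set f := (μ.rnDeriv ν x).toReal with hf
    have hf0 : 0 ≤ f := ENNReal.toReal_nonneg
    have hfg : f ≤ g x := ENNReal.toReal_le_of_le_ofReal (zero_le_one.trans (hg1 x)) hx
    have hfe : μ.rnDeriv ν x = ENNReal.ofReal f := (ENNReal.ofReal_toReal hx').symm
    rw [hfe, ← ENNReal.ofReal_add (klFun_nonneg hf0) hf0, ← ENNReal.ofReal_mul hf0,
      ← ENNReal.ofReal_one, ← ENNReal.ofReal_add (by positivity) zero_le_one]
    refine ENNReal.ofReal_le_ofReal ?_
    have : f * Real.log f ≤ f * Real.log (g x) := by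
      rcases hf0.eq_or_lt with h0 | h0
      · simp [← h0]
      · exact mul_le_mul_of_nonneg_left (Real.log_le_log h0 hfg) hf0
    rw [klFun]
    linarith
  have hint := lintegral_mono_ae hpt
  rw [lintegral_add_right _ (Measure.measurable_rnDeriv _ _), lintegral_add_right _ (by fun_prop),
    Measure.lintegral_rnDeriv hac, measure_univ, lintegral_one, measure_univ,
    ← klDiv_eq_lintegral_klFun_of_ac hac] at hint
  have h3 : ∫⁻ x, μ.rnDeriv ν x * ENNReal.ofReal (Real.log (g x)) ∂ν
      = ∫⁻ x, ENNReal.ofReal (Real.log (g x)) ∂μ := by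
    conv_rhs => rw [← hwd]
    rw [lintegral_withDensity_eq_lintegral_mul _ (Measure.measurable_rnDeriv _ _) (by fun_prop)]
    rfl
  rw [h3] at hint
  exact (ENNReal.add_le_add_iff_right ENNReal.one_ne_top).1 hint

/-- The inverse of the mass of a point, with the value `1` at points without mass. -/
def invMass {T : Type*} [MeasurableSpace T] (p : Measure T) (v : T) : ℝ :=
  if p.real {v} = 0 then 1 else (p.real {v})⁻¹

lemma one_le_invMass {T : Type*} [MeasurableSpace T] (p : Measure T) [IsProbabilityMeasure p]
    (v : T) : 1 ≤ invMass p v := by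
  rw [invMass]
  split_ifs with h
  · rfl
  · exact (one_le_inv₀ (lt_of_le_of_ne measureReal_nonneg (Ne.symm h))).2 measureReal_le_one

/-- The function is constantly `1` off the countable set `C`. `T` itself may be uncountable, as for
reconstructions in `ℝⁿ` that take countably many values. -/
lemma measurable_invMass {T : Type*} [MeasurableSpace T] [MeasurableSingletonClass T]
    (p : Measure T) [IsProbabilityMeasure p] {C : Set T} (hC : C.Countable) (hpC : p Cᶜ = 0) :
    Measurable (invMass p) := by
  have h1 : ∀ v ∉ C, invMass p v = 1 := fun v hv => by
    rw [invMass, if_pos]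
    refine (measureReal_eq_zero_iff).2 (measure_mono_null ?_ hpC)
    simpa using hv
  refine measurable_of_isOpen fun s _ => ?_
  by_cases h : (1 : ℝ) ∈ s
  · have : (invMass p ⁻¹' s)ᶜ ⊆ C := fun v hv => by
      by_contra hvC
      exact hv (by simpa [h1 v hvC] using h)
    exact (hC.mono this).measurableSet.of_compl
  · have : invMass p ⁻¹' s ⊆ C := fun v hv => by
      by_contra hvC
      exact h (by simpa [h1 v hvC] using hv)
    exact (hC.mono this).measurableSet

/-- On the slice over a point `v` of mass `p > 0`, `ν` is at most its first marginal, which is `1/p`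
times the product measure on that slice. Slices over points without mass are null, and countably
many slices carry `ν`. -/
lemma le_withDensity_invMass {S T : Type*} [MeasurableSpace S] [MeasurableSpace T]
    [MeasurableSingletonClass T] (ν : Measure (S × T)) [IsProbabilityMeasure ν]
    {C : Set T} (hC : C.Countable) (hνC : ν.snd Cᶜ = 0) :
    ν ≤ (ν.fst.prod ν.snd).withDensity fun x => ENNReal.ofReal (invMass ν.snd x.2) := by
  refine Measure.le_iff.2 fun s hs => ?_
  have hdisj : Pairwise (Function.onFun Disjoint fun v : C => s ∩ Prod.snd ⁻¹' {(v : T)}) := by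
    intro v w hvw
    refine Set.disjoint_left.2 fun x hx hx' => hvw ?_
    exact Subtype.ext (hx.2.symm.trans hx'.2)
  have hmeas : ∀ v : C, MeasurableSet (s ∩ Prod.snd ⁻¹' {(v : T)}) := fun v =>
    hs.inter (measurable_snd (measurableSet_singleton _))
  have := hC.to_subtype
  have hpiece : ∀ v : T, ν (s ∩ Prod.snd ⁻¹' {v}) ≤
      (ν.fst.prod ν.snd).withDensity (fun x => ENNReal.ofReal (invMass ν.snd x.2))
        (s ∩ Prod.snd ⁻¹' {v}) := by
    intro v
    by_cases hv : ν.snd.real {v} = 0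
    · rw [measureReal_eq_zero_iff, Measure.snd_apply (measurableSet_singleton v)] at hv
      rw [measure_mono_null Set.inter_subset_right hv]
      exact zero_le
    have hsv : MeasurableSet ((fun u : S => (u, v)) ⁻¹' s) := measurable_prodMk_right hs
    have heq : s ∩ Prod.snd ⁻¹' {v} = ((fun u : S => (u, v)) ⁻¹' s) ×ˢ {v} := by
      ext ⟨u, w⟩
      simp only [Set.mem_inter_iff, Set.mem_preimage, Set.mem_singleton_iff, Set.mem_prod]
      constructor
      · rintro ⟨h1, rfl⟩; exact ⟨h1, rfl⟩
      · rintro ⟨h1, rfl⟩; exact ⟨h1, rfl⟩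
    have hm : MeasurableSet (s ∩ Prod.snd ⁻¹' {v}) :=
      hs.inter (measurable_snd (measurableSet_singleton _))
    rw [withDensity_apply _ hm]
    calc ν (s ∩ Prod.snd ⁻¹' {v}) ≤ ν.fst ((fun u : S => (u, v)) ⁻¹' s) := by
          rw [Measure.fst_apply hsv, heq]
          exact measure_mono fun x hx => hx.1
      _ = ENNReal.ofReal (invMass ν.snd v) * (ν.fst.prod ν.snd) (s ∩ Prod.snd ⁻¹' {v}) := by
          have hv' : ν.snd {v} ≠ 0 := fun h => hv ((measureReal_eq_zero_iff).2 h)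
          rw [heq, Measure.prod_prod, invMass, if_neg hv, ENNReal.ofReal_inv_of_pos
            (lt_of_le_of_ne measureReal_nonneg (Ne.symm hv)), ofReal_measureReal,
            mul_comm (ν.fst _), ← mul_assoc, ENNReal.inv_mul_cancel hv' (measure_ne_top _ _),
            one_mul]
      _ = ∫⁻ x in s ∩ Prod.snd ⁻¹' {v}, ENNReal.ofReal (invMass ν.snd x.2)
            ∂(ν.fst.prod ν.snd) := by
          rw [← setLIntegral_const]
          refine setLIntegral_congr_fun hm fun x hx => ?_
          rw [show x.2 = v from hx.2]
  calc ν s ≤ ν (⋃ v : C, s ∩ Prod.snd ⁻¹' {(v : T)}) + ν (Prod.snd ⁻¹' Cᶜ) := by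
        refine (measure_mono ?_).trans (measure_union_le _ _)
        intro x hx
        by_cases hxC : x.2 ∈ C
        · exact Or.inl (Set.mem_iUnion.2 ⟨⟨x.2, hxC⟩, hx, rfl⟩)
        · exact Or.inr hxC
    _ = ∑' v : C, ν (s ∩ Prod.snd ⁻¹' {(v : T)}) := by
        rw [← Measure.snd_apply hC.measurableSet.compl, hνC, add_zero,
          measure_iUnion hdisj hmeas]
    _ ≤ ∑' v : C, (ν.fst.prod ν.snd).withDensity
          (fun x => ENNReal.ofReal (invMass ν.snd x.2)) (s ∩ Prod.snd ⁻¹' {(v : T)}) :=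
        ENNReal.tsum_le_tsum fun v => hpiece v
    _ ≤ _ := by
        rw [← measure_iUnion hdisj hmeas]
        exact measure_mono (Set.iUnion_subset fun v => Set.inter_subset_left)

/-- The information between a variable and a discrete one is at most the entropy of the latter. -/
lemma klDiv_le_entropy {S T : Type*} [MeasurableSpace S] [MeasurableSpace T]
    [MeasurableSingletonClass T] (ν : Measure (S × T)) [IsProbabilityMeasure ν]
    {C : Set T} (hC : C.Countable) (hνC : ν.snd Cᶜ = 0) :
    klDiv ν (ν.fst.prod ν.snd) ≤ ∫⁻ v, ENNReal.ofReal (Real.log (invMass ν.snd v)) ∂ν.snd := by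
  have hm := measurable_invMass ν.snd hC hνC
  refine (klDiv_le_lintegral_log (hm.comp measurable_snd) (fun x => one_le_invMass _ _)
    (le_withDensity_invMass ν hC hνC)).trans_eq ?_
  rw [Measure.snd, lintegral_map (by fun_prop) measurable_snd]
  rfl

/-- Gibbs' inequality for the image of a discrete law. -/
lemma entropy_map_le {𝒜 T : Type*} [MeasurableSpace 𝒜] [MeasurableSpace T] [Countable 𝒜]
    [MeasurableSingletonClass 𝒜] [MeasurableSingletonClass T]
    (l q : Measure 𝒜) [IsProbabilityMeasure l] [IsZeroOrProbabilityMeasure q]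
    (hq : ∀ a, q {a} ≠ 0) (G : 𝒜 → T) :
    ∫⁻ v, ENNReal.ofReal (Real.log (invMass (l.map G) v)) ∂(l.map G)
      ≤ ∫⁻ a, ENNReal.ofReal (-Real.log (q.real {a})) ∂l := by
  have hG : Measurable G := measurable_of_countable G
  have : IsProbabilityMeasure (l.map G) := Measure.isProbabilityMeasure_map hG.aemeasurable
  have hC : (Set.range G).Countable := Set.countable_range G
  have hCn : (l.map G) (Set.range G)ᶜ = 0 := by
    rw [Measure.map_apply hG hC.measurableSet.compl]
    simp
  rw [lintegral_map (by have := measurable_invMass _ hC hCn; fun_prop) hG]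
  have hle : ∀ a, l {a} ≤ (l.map G) {G a} := fun a => by
    rw [Measure.map_apply hG (measurableSet_singleton _)]
    exact measure_mono (by simp)
  -- This is `log t ≤ t - 1` at `t = q(a) / p(G a)`, with `p` the image law and the terms rearranged
  -- to stay nonnegative. Comparing `q` on the source with `p` on the image combines Gibbs'
  -- inequality with the loss of entropy under `G`.
  have hkey : ∫⁻ a, (ENNReal.ofReal (Real.log (invMass (l.map G) (G a))) + 1) ∂l
      ≤ ∫⁻ a, (ENNReal.ofReal (-Real.log (q.real {a})) + q {a} / (l.map G) {G a}) ∂l := by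
    rw [lintegral_countable', lintegral_countable']
    refine ENNReal.tsum_le_tsum fun a => ?_
    by_cases ha : l {a} = 0
    · simp [ha]
    refine mul_le_mul_left ?_ _
    have hp : (l.map G) {G a} ≠ 0 := fun h => ha (le_antisymm (h ▸ hle a) zero_le)
    have hp' : 0 < (l.map G).real {G a} :=
      lt_of_le_of_ne measureReal_nonneg fun h => hp ((measureReal_eq_zero_iff).1 h.symm)
    have hq' : 0 < q.real {a} :=
      lt_of_le_of_ne measureReal_nonneg fun h => hq a ((measureReal_eq_zero_iff).1 h.symm)
    rw [invMass, if_neg hp'.ne', Real.log_inv]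
    have h1 : q {a} / (l.map G) {G a} = ENNReal.ofReal (q.real {a} / (l.map G).real {G a}) := by
      rw [ENNReal.ofReal_div_of_pos hp', ofReal_measureReal, ofReal_measureReal]
    have hn1 : 0 ≤ -Real.log ((l.map G).real {G a}) :=
      neg_nonneg.2 (Real.log_nonpos hp'.le measureReal_le_one)
    have hn2 : 0 ≤ -Real.log (q.real {a}) :=
      neg_nonneg.2 (Real.log_nonpos hq'.le measureReal_le_one)
    rw [h1, ← ENNReal.ofReal_one, ← ENNReal.ofReal_add hn1 zero_le_one,
      ← ENNReal.ofReal_add hn2 (by positivity)]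
    refine ENNReal.ofReal_le_ofReal ?_
    have := Real.log_le_sub_one_of_pos (div_pos hq' hp')
    rw [Real.log_div hq'.ne' hp'.ne'] at this
    linarith
  rw [lintegral_add_right _ measurable_const, lintegral_one, measure_univ,
    lintegral_add_right _ (measurable_of_countable _)] at hkey
  -- A point has at most the mass of its fibre, so each term of the sum is at most `q {a}`.
  have hlast : ∫⁻ a, q {a} / (l.map G) {G a} ∂l ≤ 1 := by
    rw [lintegral_countable']
    calc ∑' a, q {a} / (l.map G) {G a} * l {a} ≤ ∑' a, q {a} := by
          refine ENNReal.tsum_le_tsum fun a => ?_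
          rw [div_eq_mul_inv, mul_assoc, mul_comm (_)⁻¹, ← div_eq_mul_inv]
          refine mul_le_of_le_one_right zero_le ?_
          exact ENNReal.div_le_of_le_mul (by simpa using hle a)
      _ = q Set.univ := by
          rw [← lintegral_one, lintegral_countable']
          simp
      _ ≤ 1 := prob_le_one
  exact (ENNReal.add_le_add_iff_right ENNReal.one_ne_top).1
    (hkey.trans (by gcongr))

instance : Countable Packet := inferInstanceAs (Countable (List Bool))

instance : DiscreteMeasurableSpace Packet := ⟨fun _ => trivial⟩

/-- Group the packets by length: there are `2 ^ k` of length `k`. -/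
lemma tsum_packet_pow_length (r : ℝ≥0∞) : ∑' a : Packet, r ^ a.length = ∑' k, (2 * r) ^ k := by
  rw [← (Equiv.sigmaFiberEquiv Packet.length).tsum_eq, ENNReal.tsum_sigma']
  refine tsum_congr fun k => ?_
  have h : ∀ b : {a : Packet // a.length = k},
      r ^ (Equiv.sigmaFiberEquiv Packet.length ⟨k, b⟩).length = r ^ k := fun b => by
    rw [Equiv.sigmaFiberEquiv_apply, b.2]
  simp_rw [h]
  have : Fintype {a : Packet // a.length = k} := inferInstanceAs (Fintype (List.Vector Bool k))
  have hc : Fintype.card {a : Packet // a.length = k} = 2 ^ k := by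
    have : Fintype.card (List.Vector Bool k) = 2 ^ k := by simp
    rw [← this]
    exact Fintype.card_congr (Equiv.refl _)
  rw [tsum_fintype, Finset.sum_const, Finset.card_univ, hc, mul_pow, nsmul_eq_mul]
  push_cast
  rfl

/-- The law of a packet of geometric length with mean `M`, uniform given its length. -/
def geometricPacket (M : ℝ) : Measure Packet :=
  Measure.count.withDensity fun a =>
    ENNReal.ofReal (1 + M)⁻¹ * ENNReal.ofReal (M / (2 * (1 + M))) ^ a.length

lemma geometricPacket_singleton (M : ℝ) (a : Packet) :
    geometricPacket M {a}
      = ENNReal.ofReal (1 + M)⁻¹ * ENNReal.ofReal (M / (2 * (1 + M))) ^ a.length := by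
  rw [geometricPacket, withDensity_apply _ (measurableSet_singleton a), lintegral_singleton]
  simp

lemma isProbabilityMeasure_geometricPacket {M : ℝ} (hM : 0 < M) :
    IsProbabilityMeasure (geometricPacket M) := by
  constructor
  have h2 : (2 : ℝ≥0∞) * ENNReal.ofReal (M / (2 * (1 + M))) = ENNReal.ofReal (M / (1 + M)) := by
    rw [← ENNReal.ofReal_ofNat, ← ENNReal.ofReal_mul (by norm_num)]
    congr 1
    field_simp
  have h3 : (1 : ℝ≥0∞) - ENNReal.ofReal (M / (1 + M)) = ENNReal.ofReal (1 + M)⁻¹ := by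
    rw [← ENNReal.ofReal_one, ← ENNReal.ofReal_sub _ (by positivity)]
    congr 1
    field_simp
    ring
  rw [geometricPacket, withDensity_apply _ MeasurableSet.univ, Measure.restrict_univ,
    lintegral_count, ENNReal.tsum_mul_left, tsum_packet_pow_length, h2, ENNReal.tsum_geometric, h3]
  refine ENNReal.mul_inv_cancel ?_ ENNReal.ofReal_ne_top
  exact (ENNReal.ofReal_pos.2 (by positivity)).ne'

/-- The information carried by packets of mean total length `L` is at most
`K log₂ (1 + M) + L (1 + log₂ (1 + M) - log₂ M)`, for every `M > 0`. -/
lemma mutualInfo_map_le {S T : Type*} [MeasurableSpace S] [MeasurableSpace T]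
    [MeasurableSingletonClass T] {K : ℕ} (ν : Measure (S × (Fin K → Packet)))
    [IsProbabilityMeasure ν] (G : (Fin K → Packet) → T) {M : ℝ} (hM : 0 < M) :
    mutualInfo (ν.map (Prod.map id G)) ≤ ENNReal.ofReal (K * Real.logb 2 (1 + M))
      + ENNReal.ofReal (1 + Real.logb 2 (1 + M) - Real.logb 2 M)
        * ∫⁻ p, ∑ i, ((p.2 i).length : ℝ≥0∞) ∂ν := by
  have hG : Measurable G := measurable_of_countable G
  have hprob := isProbabilityMeasure_geometricPacket hM
  have : IsProbabilityMeasure (ν.map (Prod.map id G)) :=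
    Measure.isProbabilityMeasure_map (by fun_prop)
  have hsnd : (ν.map (Prod.map id G)).snd = ν.snd.map G := by
    rw [Measure.snd, Measure.snd, Measure.map_map measurable_snd (by fun_prop),
      Measure.map_map hG measurable_snd]
    rfl
  have hlog2 : 0 < Real.log 2 := Real.log_pos one_lt_two
  have hr : 0 < M / (2 * (1 + M)) := by positivity
  have hqs (a : Fin K → Packet) : (Measure.pi fun _ : Fin K => geometricPacket M) {a}
      = ENNReal.ofReal (∏ i, ((1 + M)⁻¹ * (M / (2 * (1 + M))) ^ (a i).length)) := by
    rw [Measure.pi_singleton, ENNReal.ofReal_prod_of_nonneg fun i _ => by positivity]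
    refine Finset.prod_congr rfl fun i _ => ?_
    rw [geometricPacket_singleton, ENNReal.ofReal_mul (by positivity),
      ENNReal.ofReal_pow (by positivity)]
  have hqpos (a : Fin K → Packet) :
      0 < ∏ i, ((1 + M)⁻¹ * (M / (2 * (1 + M))) ^ (a i).length) :=
    Finset.prod_pos fun i _ => by positivity
  have hent := klDiv_le_entropy (ν.map (Prod.map id G)) (C := Set.range G)
    (Set.countable_range G) (by
      rw [hsnd, Measure.map_apply hG (Set.countable_range G).measurableSet.compl]
      simp)
  have hgibbs := entropy_map_le ν.snd (Measure.pi fun _ : Fin K => geometricPacket M)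
    (fun a => by rw [hqs]; exact (ENNReal.ofReal_pos.2 (hqpos a)).ne') G
  rw [← hsnd] at hgibbs
  replace hent := hent.trans hgibbs
  have hc : 0 ≤ 1 + Real.logb 2 (1 + M) - Real.logb 2 M := by
    have : Real.logb 2 M ≤ Real.logb 2 (1 + M) :=
      Real.logb_le_logb_of_le one_lt_two hM (by linarith)
    linarith
  have hb : 0 ≤ Real.logb 2 (1 + M) := Real.logb_nonneg one_lt_two (by linarith)
  -- The log-mass under the product reference is affine in the total length, so its mean involves
  -- the packets only through their mean total length.
  have hval (a : Fin K → Packet) :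
      ENNReal.ofReal (-Real.log ((Measure.pi fun _ : Fin K => geometricPacket M).real {a}))
        = ENNReal.ofReal (Real.log 2) * (ENNReal.ofReal (K * Real.logb 2 (1 + M))
          + ENNReal.ofReal (1 + Real.logb 2 (1 + M) - Real.logb 2 M)
            * ∑ i, ((a i).length : ℝ≥0∞)) := by
    have h1 : ∑ i, ((a i).length : ℝ≥0∞) = ENNReal.ofReal (∑ i, ((a i).length : ℝ)) := by
      rw [ENNReal.ofReal_sum_of_nonneg fun i _ => by positivity]
      simp
    rw [measureReal_def, hqs, ENNReal.toReal_ofReal (hqpos a).le, h1,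
      ← ENNReal.ofReal_mul hc, ← ENNReal.ofReal_add (by positivity)
        (mul_nonneg hc (Finset.sum_nonneg fun i _ => by positivity)),
      ← ENNReal.ofReal_mul hlog2.le, Real.log_prod fun i _ => by positivity]
    congr 1
    have h2 (i : Fin K) : Real.log ((1 + M)⁻¹ * (M / (2 * (1 + M))) ^ (a i).length)
        = -(Real.log (1 + M)) - (a i).length
          * (Real.log 2 + Real.log (1 + M) - Real.log M) := by
      rw [Real.log_mul (by positivity) (by positivity), Real.log_inv, Real.log_pow,
        Real.log_div (by positivity) (by positivity), Real.log_mul (by positivity) (by positivity)]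
      ring
    simp_rw [h2, Finset.sum_sub_distrib, ← Finset.sum_mul]
    simp only [Finset.sum_const, Finset.card_univ, Fintype.card_fin, nsmul_eq_mul, Real.logb]
    field_simp
    ring
  simp_rw [hval] at hent
  have hmeas : Measurable fun a : Fin K → Packet => ∑ i, ((a i).length : ℝ≥0∞) :=
    measurable_of_countable _
  rw [lintegral_const_mul _ (measurable_of_countable _), lintegral_add_left measurable_const,
    lintegral_const, measure_univ, mul_one, lintegral_const_mul _ hmeas,
    show ν.snd = ν.map Prod.snd from rfl, lintegral_map hmeas measurable_snd] at hent
  rw [mutualInfo]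
  exact ENNReal.div_le_of_le_mul' hent

/-- Dropping the last letter. -/
lemma lintegral_jointLaw_succ_init {Ω E Y : Type*} [MeasurableSpace Ω] [MeasurableSpace E]
    [MeasurableSpace Y] (P : Measure Ω) {x : ℕ → Ω → E} (hx : ∀ i, Measurable (x i))
    (π : CausalPolicy E Y) (K : ℕ) {f : Ω × (Fin K → Y) → ℝ≥0∞} (hf : Measurable f) :
    ∫⁻ p, f (p.1, Fin.init p.2) ∂jointLaw P x π (K + 1) = ∫⁻ p, f p ∂jointLaw P x π K := by
  rw [lintegral_jointLaw_succ P hx π K (f := fun p => f (p.1, Fin.init p.2))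
    (hf.comp (measurable_fst.prodMk (measurable_finInit.comp measurable_snd)))]
  simp

lemma lintegral_sum_length {Ω E : Type*} [MeasurableSpace Ω] [MeasurableSpace E] (P : Measure Ω)
    {x : ℕ → Ω → E} (hx : ∀ i, Measurable (x i)) (π : CausalPolicy E Packet) (K : ℕ) :
    ∫⁻ p, ∑ i, ((p.2 i).length : ℝ≥0∞) ∂jointLaw P x π K
      = ∑ k ∈ Finset.range K, expectedLength P x π k := by
  have hl := measurable_packetLength
  induction K with
  | zero => simp
  | succ K ih =>
    simp_rw [Fin.sum_univ_castSucc]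
    rw [lintegral_add_right _ (by fun_prop), Finset.sum_range_succ, ← ih,
      ← lintegral_jointLaw_succ_init P hx π K (f := fun p => ∑ i, ((p.2 i).length : ℝ≥0∞))
        (by fun_prop)]
    rfl

end Information

/-! ### From an encoding policy to a reconstruction policy -/

section Reconstruction

variable {Ω E Y V : Type*}

/-- The sequence obtained by applying the causal decoders `g 0, g 1, …` to a sequence of
letters. -/
def decode (g : (k : ℕ) → (Fin (k + 1) → Y) → V) (K : ℕ) (a : Fin K → Y) : Fin K → V :=
  fun i => g i fun j => a (Fin.castLE i.isLt j)

lemma decode_succ (g : (k : ℕ) → (Fin (k + 1) → Y) → V) (K : ℕ) (a : Fin (K + 1) → Y) :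
    decode g (K + 1) a = Fin.snoc (decode g K (Fin.init a)) (g K a) := by
  funext i
  refine Fin.lastCases ?_ (fun j => ?_) i
  · simp [decode]
  · simp [decode, Fin.init]

variable [MeasurableSpace Ω] [MeasurableSpace E] [MeasurableSpace Y] [MeasurableSpace V]

lemma measurable_decode {g : (k : ℕ) → (Fin (k + 1) → Y) → V} (hg : ∀ k, Measurable (g k))
    (K : ℕ) : Measurable (decode g K) := by
  refine measurable_pi_iff.2 fun i => ?_
  exact (hg i).comp (by fun_prop)

variable [StandardBorelSpace V] [Nonempty V]

/-- The reconstruction policy that draws each reconstruction from its regular conditional law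
given the previous ones and the source symbols. -/
def reconPolicy (P : Measure Ω) [IsProbabilityMeasure P] (x : ℕ → Ω → E)
    (hx : ∀ i, Measurable (x i)) (π : CausalPolicy E Y) (g : (k : ℕ) → (Fin (k + 1) → Y) → V) :
    CausalPolicy E V where
  kernel k :=
    have := isProbabilityMeasure_jointLaw P hx π (k + 1)
    condDistrib (fun p : Ω × (Fin (k + 1) → Y) => g k p.2)
      (fun p => (decode g k (Fin.init p.2), fun i : Fin (k + 1) => x i p.1))
      (jointLaw P x π (k + 1))
  isMarkov k := by infer_instance

lemma reconPolicy_kernel_compProd (P : Measure Ω) [IsProbabilityMeasure P] {x : ℕ → Ω → E}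
    (hx : ∀ i, Measurable (x i)) (π : CausalPolicy E Y) {g : (k : ℕ) → (Fin (k + 1) → Y) → V}
    (hg : ∀ k, Measurable (g k)) (K : ℕ) :
    ((jointLaw P x π (K + 1)).map
        (fun p => (decode g K (Fin.init p.2), fun i : Fin (K + 1) => x i p.1)))
        ⊗ₘ ((reconPolicy P x hx π g).kernel K)
      = (jointLaw P x π (K + 1)).map
          (fun p => ((decode g K (Fin.init p.2), fun i : Fin (K + 1) => x i p.1), g K p.2)) := by
  have := isProbabilityMeasure_jointLaw P hx π (K + 1)
  have hgK := hg K
  exact compProd_map_condDistrib (by fun_prop)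

/-- Induction on `K`. The new kernel is a conditional law given the decoded past and `x(0 : K)`, so
it reproduces the next letter once that pair has the right law. The induction hypothesis only covers
`x(0 : K-1)`; the additional symbol `x(K)` does no harm because, under both policies, the first `K`
letters depend on `ω` only through `x(0 : K-1)`. -/
lemma jointLaw_reconPolicy (P : Measure Ω) [IsProbabilityMeasure P] {x : ℕ → Ω → E}
    (hx : ∀ i, Measurable (x i)) (π : CausalPolicy E Y) {g : (k : ℕ) → (Fin (k + 1) → Y) → V}
    (hg : ∀ k, Measurable (g k)) (K : ℕ) :
    (jointLaw P x (reconPolicy P x hx π g) K).map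
        (fun p => ((fun i : Fin K => x i p.1), p.2))
      = (jointLaw P x π K).map (fun p => ((fun i : Fin K => x i p.1), decode g K p.2)) := by
  have hG := fun K => measurable_decode hg K
  have hxm := fun K => measurable_finProcess hx K
  induction K with
  | zero =>
    have h : ∀ a : Fin 0 → Y, decode g 0 a = Fin.elim0 := fun a => Subsingleton.elim _ _
    simp_rw [h]
    rw [jointLaw, jointLaw, Measure.map_map (by fun_prop) (by fun_prop),
      Measure.map_map (by fun_prop) (by fun_prop)]
    rfl
  | succ K ih =>
    set π' := reconPolicy P x hx π g with hπ'
    have hgK := hg K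
    have hGK := hG K
    have hGK1 := hG (K + 1)
    have hsn : Measurable fun q : (Fin K → V) × V => (Fin.snoc q.1 q.2 : Fin (K + 1) → V) :=
      measurable_finSnoc
    -- Uniqueness of disintegration upgrades the equality of joint laws to equality of kernels for
    -- almost every `ω`, so that the whole of `ω`, and `x(K)` in particular, can be carried along.
    have hae : ∀ᵐ ω ∂P, policyKernel π' K (fun i => x i ω)
        = (policyKernel π K).map (decode g K) (fun i => x i ω) := by
      have hprob : IsProbabilityMeasure (P.map fun ω (i : Fin K) => x i ω) :=
        Measure.isProbabilityMeasure_map (hxm K).aemeasurable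
      have : IsMarkovKernel ((policyKernel π K).map (decode g K)) :=
        Kernel.IsMarkovKernel.map _ hGK
      refine ae_of_ae_map (hxm K).aemeasurable (Kernel.ae_eq_of_compProd_eq ?_)
      rw [← jointLaw_map P hx, ih, Measure.compProd_map hGK, ← jointLaw_map P hx,
        Measure.map_map (by fun_prop) (by fun_prop)]
      rfl
    have hinit : Measurable fun a : Fin (K + 1) → Y => (Fin.init a : Fin K → Y) :=
      measurable_finInit
    refine Measure.ext_of_lintegral _ fun f hf => ?_
    have hF : Measurable fun q : (Fin K → V) × (Fin (K + 1) → E) =>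
        ∫⁻ y, f (q.2, Fin.snoc q.1 y) ∂π'.kernel K q :=
      Measurable.lintegral_kernel_prod_right' (κ := π'.kernel K)
        (f := fun r => f (r.1.2, Fin.snoc r.1.1 r.2))
        (hf.comp (measurable_fst.snd.prodMk
          (measurable_finSnoc.comp (measurable_fst.fst.prodMk measurable_snd))))
    calc ∫⁻ q, f q ∂(jointLaw P x π' (K + 1)).map
          (fun p => ((fun i : Fin (K + 1) => x i p.1), p.2))
        = ∫⁻ p, ∫⁻ y, f ((fun i : Fin (K + 1) => x i p.1), Fin.snoc p.2 y)
            ∂π'.kernel K (p.2, fun i => x i p.1) ∂jointLaw P x π' K := by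
          rw [lintegral_map hf (by fun_prop),
            lintegral_jointLaw_succ P hx π' K
              (f := fun p => f ((fun i : Fin (K + 1) => x i p.1), p.2)) (by fun_prop)]
      _ = ∫⁻ ω, ∫⁻ v, ∫⁻ y, f ((fun i : Fin (K + 1) => x i ω), Fin.snoc v y)
            ∂π'.kernel K (v, fun i => x i ω) ∂policyKernel π' K (fun i => x i ω) ∂P := by
          rw [jointLaw_eq_compProd P hx, Measure.lintegral_compProd]
          · rfl
          · exact hF.comp (by fun_prop :
              Measurable fun p : Ω × (Fin K → V) => (p.2, fun i : Fin (K + 1) => x i p.1))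
      _ = ∫⁻ ω, ∫⁻ a, ∫⁻ y, f ((fun i : Fin (K + 1) => x i ω), Fin.snoc (decode g K a) y)
            ∂π'.kernel K (decode g K a, fun i => x i ω)
              ∂policyKernel π K (fun i => x i ω) ∂P := by
          refine lintegral_congr_ae ?_
          filter_upwards [hae] with ω hω
          rw [hω, Kernel.lintegral_map _ hGK]
          exact hF.comp (by fun_prop :
            Measurable fun v : Fin K → V => (v, fun i : Fin (K + 1) => x i ω))
      _ = ∫⁻ p, ∫⁻ y, f ((fun i : Fin (K + 1) => x i p.1), Fin.snoc (decode g K p.2) y)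
            ∂π'.kernel K (decode g K p.2, fun i => x i p.1) ∂jointLaw P x π K := by
          rw [jointLaw_eq_compProd P hx, Measure.lintegral_compProd]
          · rfl
          · exact hF.comp (by fun_prop : Measurable fun p : Ω × (Fin K → Y) =>
              (decode g K p.2, fun i : Fin (K + 1) => x i p.1))
      -- Reinstate letter `K`, which the integrand ignores: the conditional law defining the kernel
      -- was taken under the law of `K + 1` letters.
      _ = ∫⁻ p, ∫⁻ y, f ((fun i : Fin (K + 1) => x i p.1),
              Fin.snoc (decode g K (Fin.init p.2)) y)
            ∂π'.kernel K (decode g K (Fin.init p.2), fun i => x i p.1)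
              ∂jointLaw P x π (K + 1) := by
          rw [← lintegral_jointLaw_succ_init P hx π K]
          exact hF.comp (by fun_prop : Measurable fun p : Ω × (Fin K → Y) =>
            (decode g K p.2, fun i : Fin (K + 1) => x i p.1))
      _ = ∫⁻ r, f (r.1.2, Fin.snoc r.1.1 r.2) ∂((jointLaw P x π (K + 1)).map
            (fun p => (decode g K (Fin.init p.2), fun i : Fin (K + 1) => x i p.1)))
            ⊗ₘ (π'.kernel K) := by
          have := isProbabilityMeasure_jointLaw P hx π (K + 1)
          rw [Measure.lintegral_compProd, lintegral_map hF (by fun_prop)]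
          exact hf.comp (measurable_fst.snd.prodMk
            (measurable_finSnoc.comp (measurable_fst.fst.prodMk measurable_snd)))
      _ = ∫⁻ p, f ((fun i : Fin (K + 1) => x i p.1), decode g (K + 1) p.2)
            ∂jointLaw P x π (K + 1) := by
          rw [hπ', reconPolicy_kernel_compProd P hx π hg, lintegral_map _ (by fun_prop)]
          · simp_rw [decode_succ]
          · exact hf.comp (measurable_fst.snd.prodMk
              (measurable_finSnoc.comp (measurable_fst.fst.prodMk measurable_snd)))
      _ = _ := by rw [lintegral_map hf (by fun_prop)]

end Reconstruction

/-! ### The information-theoretic lower bound on the bitrate -/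

section Converse

variable {n : ℕ}

instance (S₀ : Matrix (Fin n) (Fin n) ℝ) : IsProbabilityMeasure (dtSource S₀) := by
  rw [dtSource]; infer_instance

lemma measurable_dtState (A B : Matrix (Fin n) (Fin n) ℝ) (τ : ℝ) (k : ℕ) :
    Measurable (dtState A B τ k) := by
  induction k with
  | zero => exact measurable_fst
  | succ k ih =>
    have : dtState A B τ (k + 1) = fun p =>
      Matrix.toEuclideanCLM (𝕜 := ℝ) (expA A τ) (dtState A B τ k p)
      + Matrix.toEuclideanCLM (𝕜 := ℝ) (noiseRoot A B τ) (p.2 k) := rfl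
    rw [this]
    fun_prop

/-- Doob–Dynkin factorisation: it provides the decoder. -/
lemma exists_estimate_eq {Ω : Type*} [MeasurableSpace Ω] (P : Measure Ω) (x : ℕ → Ω → Vec n)
    (π : CausalPolicy (Vec n) Packet) (k : ℕ) (Z : Ω → Vec n) :
    ∃ g : (Fin (k + 1) → Packet) → Vec n, Measurable g ∧
      estimate P x π k Z = g ∘ Prod.snd := by
  refine Measurable.exists_eq_measurable_comp ?_
  exact stronglyMeasurable_condExp.measurable

/-- Taking the estimates as decoders keeps the error unchanged, and the reconstructions carry no
more information than the packets they are computed from. The bound is left free in `M`, to be fixed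
once the bitrate is known. -/
lemma exists_reconPolicy {Ω : Type*} [MeasurableSpace Ω] (P : Measure Ω) [IsProbabilityMeasure P]
    {x : ℕ → Ω → Vec n} (hx : ∀ i, Measurable (x i)) (π : CausalPolicy (Vec n) Packet) :
    ∃ π' : CausalPolicy (Vec n) (Vec n),
      (∀ k, ∀ w : Vec n → ℝ≥0∞, Measurable w →
        ∫⁻ p, w (x k p.1 - p.2 (Fin.last k)) ∂jointLaw P x π' (k + 1)
          = ∫⁻ p, w (x k p.1 - estimate P x π k (x k) p) ∂jointLaw P x π (k + 1)) ∧
      ∀ (K : ℕ) (M : ℝ), 0 < M →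
        mutualInfo ((jointLaw P x π' K).map fun p => ((fun i : Fin K => x i p.1), p.2))
          ≤ ENNReal.ofReal (K * Real.logb 2 (1 + M))
            + ENNReal.ofReal (1 + Real.logb 2 (1 + M) - Real.logb 2 M)
              * ∑ k ∈ Finset.range K, expectedLength P x π k := by
  choose g hg hge using fun k => exists_estimate_eq P x π k (x k)
  refine ⟨reconPolicy P x hx π g, fun k w hw => ?_, fun K M hM => ?_⟩
  · have h := congrArg (fun m => ∫⁻ q, w (q.1 (Fin.last k) - q.2 (Fin.last k)) ∂m)
      (jointLaw_reconPolicy P hx π hg (k + 1))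
    have hG := measurable_decode hg (k + 1)
    simp only at h
    rw [lintegral_map (by fun_prop) (by fun_prop), lintegral_map (by fun_prop) (by fun_prop)] at h
    refine h.trans (lintegral_congr fun p => ?_)
    rw [hge]
    rfl
  · rw [jointLaw_reconPolicy P hx π hg]
    have := isProbabilityMeasure_jointLaw P hx π K
    have hG := measurable_decode hg K
    have hxm := measurable_finProcess hx K
    have hprob : IsProbabilityMeasure ((jointLaw P x π K).map
      fun p => ((fun i : Fin K => x i p.1), p.2)) := Measure.isProbabilityMeasure_map (by fun_prop)
    have h := mutualInfo_map_le ((jointLaw P x π K).map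
      fun p => ((fun i : Fin K => x i p.1), p.2)) (decode g K) hM
    have hl := measurable_packetLength
    rw [Measure.map_map (by fun_prop) (by fun_prop), lintegral_map (by fun_prop) (by fun_prop),
      lintegral_sum_length P hx π K] at h
    exact h

lemma thetaInvExt_causalRDF_le (A B S₀ Q : Matrix (Fin n) (Fin n) ℝ) (D : ℝ) {τ : ℝ≥0}
    (hτ : 0 < τ) :
    thetaInvExt (causalRDF A B S₀ D Q τ) / τ ≤ minBitrateDT A B S₀ D Q τ := by
  refine le_iInf₂ fun π hπ => ?_
  have hx := measurable_dtState A B τ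
  obtain ⟨π', hdist, hinfo⟩ := exists_reconPolicy (dtSource S₀) hx π
  have hfeas : (reconDistortion A B S₀ Q τ π' : EReal) ≤ (D : EReal) := by
    have : reconDistortion A B S₀ Q τ π' = dtDistortion A B S₀ Q τ π := by
      simp only [reconDistortion, dtDistortion, hdist _ _ (measurable_weightedSq Q)]
    rwa [this]
  have hR : causalRDF A B S₀ D Q τ ≤ infoRate A B S₀ τ π' := iInf₂_le π' hfeas
  have hτ0 : (τ : ℝ≥0∞) ≠ 0 := by simpa using hτ.ne'
  -- A rate `c` strictly above the bitrate bounds the averages eventually, and makes `M = cτ`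
  -- positive even at zero bitrate, as the geometric reference law requires.
  refine le_of_forall_gt_imp_ge_of_dense fun c hc => ?_
  by_cases hct : c = ∞
  · simp [hct]
  refine ENNReal.div_le_of_le_mul ?_
  have hMt : c * τ ≠ ∞ := ENNReal.mul_ne_top hct ENNReal.coe_ne_top
  have hM0 : c * τ ≠ 0 := mul_ne_zero (ne_bot_of_gt hc) hτ0
  have hM : 0 < (c * τ).toReal := ENNReal.toReal_pos hM0 hMt
  rw [← ENNReal.ofReal_toReal hMt]
  refine thetaInvExt_le_ofReal hM.le (hR.trans ?_)
  set M := (c * τ).toReal with hMdef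
  have hcM : c * τ = ENNReal.ofReal M := (ENNReal.ofReal_toReal hMt).symm
  have hb : 0 ≤ Real.logb 2 (1 + M) := Real.logb_nonneg one_lt_two (by linarith)
  have hd : 0 ≤ 1 + Real.logb 2 (1 + M) - Real.logb 2 M := by
    have : Real.logb 2 M ≤ Real.logb 2 (1 + M) :=
      Real.logb_le_logb_of_le one_lt_two hM (by linarith)
    linarith
  refine limsup_le_of_le (by isBoundedDefault) ?_
  filter_upwards [eventually_lt_of_limsup_lt hc, eventually_gt_atTop 0] with K hK hK0
  have hK0' : (K : ℝ≥0∞) ≠ 0 := by simpa using hK0.ne'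
  have hsum : ∑ k ∈ Finset.range K, expectedLength (dtSource S₀) (dtState A B τ) π k
      ≤ K * ENNReal.ofReal M := by
    have := (ENNReal.div_le_iff (mul_ne_zero hK0' hτ0)
      (ENNReal.mul_ne_top (ENNReal.natCast_ne_top K) ENNReal.coe_ne_top)).1 hK.le
    rw [← hcM]
    calc _ ≤ _ := this
      _ = _ := by ring
  refine ENNReal.div_le_of_le_mul ?_
  calc _ ≤ _ := hinfo K M hM
    _ ≤ ENNReal.ofReal (K * Real.logb 2 (1 + M))
        + ENNReal.ofReal (1 + Real.logb 2 (1 + M) - Real.logb 2 M)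
          * (K * ENNReal.ofReal M) := by gcongr
    -- The tangent line `log₂(1+M) + L (1 + log₂(1+M) - log₂ M)` takes the value `θ(M)` at its point
    -- of contact `L = M`.
    _ = ENNReal.ofReal (theta M) * K := by
      rw [← ENNReal.ofReal_natCast, ← ENNReal.ofReal_mul (by positivity),
        ← ENNReal.ofReal_mul hd, ← ENNReal.ofReal_add (by positivity) (by positivity),
        ← ENNReal.ofReal_mul (hM.le.trans (self_le_theta hM.le)), theta]
      congr 1
      ring

end Converse

/-! ### Independence of limits, of pairs and of families -/

section Independence

variable {Ω : Type*} [MeasurableSpace Ω] {P : Measure Ω}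

/-- Independence is tested on bounded continuous functions, whose product formula passes to the
limit by dominated convergence. -/
lemma indepFun_of_tendsto_ae [IsProbabilityMeasure P] {F G : Type*} [PseudoMetricSpace F]
    [MeasurableSpace F] [BorelSpace F] [PseudoMetricSpace G] [MeasurableSpace G] [BorelSpace G]
    {f : ℕ → Ω → F} {g : ℕ → Ω → G} {f' : Ω → F} {g' : Ω → G} (hf : ∀ m, Measurable (f m))
    (hg : ∀ m, Measurable (g m)) (hf' : Measurable f') (hg' : Measurable g')
    (h : ∀ m, IndepFun (f m) (g m) P)
    (hft : ∀ᵐ ω ∂P, Tendsto (fun m => f m ω) atTop (nhds (f' ω)))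
    (hgt : ∀ᵐ ω ∂P, Tendsto (fun m => g m ω) atTop (nhds (g' ω))) : IndepFun f' g' P := by
  refine indepFun_of_bcf hf'.aemeasurable hg'.aemeasurable fun φ ψ => ?_
  have hφ : Measurable φ := φ.continuous.measurable
  have hψ : Measurable ψ := ψ.continuous.measurable
  have h1 : Tendsto (fun m => ∫ ω, φ (f m ω) ∂P) atTop (nhds (∫ ω, φ (f' ω) ∂P)) := by
    refine tendsto_integral_of_dominated_convergence (fun _ => ‖φ‖)
      (fun m => (hφ.comp (hf m)).aestronglyMeasurable) (integrable_const _)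
      (fun m => ae_of_all _ fun ω => φ.norm_coe_le_norm _) ?_
    filter_upwards [hft] with ω hω using (φ.continuous.tendsto _).comp hω
  have h2 : Tendsto (fun m => ∫ ω, ψ (g m ω) ∂P) atTop (nhds (∫ ω, ψ (g' ω) ∂P)) := by
    refine tendsto_integral_of_dominated_convergence (fun _ => ‖ψ‖)
      (fun m => (hψ.comp (hg m)).aestronglyMeasurable) (integrable_const _)
      (fun m => ae_of_all _ fun ω => ψ.norm_coe_le_norm _) ?_
    filter_upwards [hgt] with ω hω using (ψ.continuous.tendsto _).comp hω
  have h3 : Tendsto (fun m => ∫ ω, φ (f m ω) * ψ (g m ω) ∂P) atTop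
      (nhds (∫ ω, φ (f' ω) * ψ (g' ω) ∂P)) := by
    refine tendsto_integral_of_dominated_convergence (fun _ => ‖φ‖ * ‖ψ‖)
      (fun m => ((hφ.comp (hf m)).mul (hψ.comp (hg m))).aestronglyMeasurable)
      (integrable_const _) (fun m => ae_of_all _ fun ω => ?_) ?_
    · rw [norm_mul]
      exact mul_le_mul (φ.norm_coe_le_norm _) (ψ.norm_coe_le_norm _) (norm_nonneg _)
        (norm_nonneg _)
    · filter_upwards [hft, hgt] with ω hω hω'
      exact ((φ.continuous.tendsto _).comp hω).mul ((ψ.continuous.tendsto _).comp hω')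
  refine tendsto_nhds_unique h3 ?_
  refine (h1.mul h2).congr fun m => ?_
  exact (IndepFun.integral_fun_mul_eq_mul_integral ((h m).comp hφ hψ)
    (hφ.comp (hf m)).aestronglyMeasurable (hψ.comp (hg m)).aestronglyMeasurable).symm

lemma indepFun_prodMk_left [IsProbabilityMeasure P] {S T U : Type*} [MeasurableSpace S]
    [MeasurableSpace T] [MeasurableSpace U] {f : Ω → S} {g : Ω → T} {h : Ω → U}
    (hf : Measurable f) (hg : Measurable g) (hh : Measurable h)
    (h1 : IndepFun f (fun ω => (g ω, h ω)) P) (h2 : IndepFun g h P) :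
    IndepFun (fun ω => (f ω, g ω)) h P := by
  have hfg : IndepFun f g P := h1.comp measurable_id measurable_fst
  rw [indepFun_iff_map_prod_eq_prod_map_map (by fun_prop) (by fun_prop)] at h1 h2 hfg ⊢
  have : IsProbabilityMeasure (P.map f) := Measure.isProbabilityMeasure_map hf.aemeasurable
  have : IsProbabilityMeasure (P.map g) := Measure.isProbabilityMeasure_map hg.aemeasurable
  have : IsProbabilityMeasure (P.map h) := Measure.isProbabilityMeasure_map hh.aemeasurable
  have ha := congrArg (Measure.map MeasurableEquiv.prodAssoc.symm)
    (Measure.prodAssoc_prod (μ := P.map f) (ν := P.map g) (τ := P.map h))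
  rw [MeasurableEquiv.map_symm_map, ← h2, ← h1,
    Measure.map_map (by fun_prop) (by fun_prop)] at ha
  rw [hfg, ha]
  rfl

/-- Transfers the independence of past and future from each coordinate of the Brownian motion to the
vector: the product over `i` of `μ_i × ν_i` is regrouped. -/
lemma indepFun_pi_of_iIndepFun_prodMk [IsProbabilityMeasure P] {ι S T : Type*} [Fintype ι]
    [MeasurableSpace S] [MeasurableSpace T] {f : ι → Ω → S} {g : ι → Ω → T}
    (hf : ∀ i, Measurable (f i)) (hg : ∀ i, Measurable (g i))
    (h : iIndepFun (fun i ω => (f i ω, g i ω)) P) (hi : ∀ i, IndepFun (f i) (g i) P) :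
    IndepFun (fun ω i => f i ω) (fun ω i => g i ω) P := by
  have hfi : iIndepFun f P := h.comp (fun _ => Prod.fst) fun _ => measurable_fst
  have hgi : iIndepFun g P := h.comp (fun _ => Prod.snd) fun _ => measurable_snd
  rw [iIndepFun_iff_map_fun_eq_pi_map (by fun_prop)] at h hfi hgi
  rw [indepFun_iff_map_prod_eq_prod_map_map (by fun_prop) (by fun_prop), hfi, hgi]
  have h1 : ∀ i, P.map (fun ω => (f i ω, g i ω)) = (P.map (f i)).prod (P.map (g i)) := fun i =>
    (indepFun_iff_map_prod_eq_prod_map_map (hf i).aemeasurable (hg i).aemeasurable).1 (hi i)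
  have : ∀ i, IsProbabilityMeasure (P.map (f i)) := fun i =>
    Measure.isProbabilityMeasure_map (hf i).aemeasurable
  have : ∀ i, IsProbabilityMeasure (P.map (g i)) := fun i =>
    Measure.isProbabilityMeasure_map (hg i).aemeasurable
  simp_rw [h1] at h
  rw [← (measurePreserving_arrowProdEquivProdArrow S T ι (fun i => P.map (f i))
    (fun i => P.map (g i))).map_eq, ← h, Measure.map_map (by fun_prop) (by fun_prop)]
  rfl

end Independence

/-! ### Convergence of Euler sums -/

section Euler

variable {F : Type*} [NormedAddCommGroup F]

/-- There are `m` terms, each uniformly `o(1/m)`. -/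
lemma tendsto_sum_of_forall_norm_le {u : ℝ} (hu : 0 ≤ u) {G : ℕ → ℕ → F}
    (h : ∀ ε > 0, ∀ᶠ m : ℕ in atTop, ∀ i < m, ‖G m i‖ ≤ ε * (u / m)) :
    Tendsto (fun m => ∑ i ∈ Finset.range m, G m i) atTop (nhds 0) := by
  rw [NormedAddGroup.tendsto_nhds_zero]
  intro ε hε
  have hu1 : 0 < u + 1 := by linarith
  filter_upwards [h (ε / (u + 1)) (by positivity), eventually_gt_atTop 0] with m hm hm0
  have hm0' : (0 : ℝ) < m := by exact_mod_cast hm0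
  calc ‖∑ i ∈ Finset.range m, G m i‖ ≤ ∑ i ∈ Finset.range m, ε / (u + 1) * (u / m) :=
        norm_sum_le_of_le _ fun i hi => hm i (Finset.mem_range.1 hi)
    _ = ε / (u + 1) * u := by
        rw [Finset.sum_const, Finset.card_range, nsmul_eq_mul]
        field_simp
    _ < ε / (u + 1) * (u + 1) := by gcongr; linarith
    _ = ε := by field_simp

lemma eventually_norm_sub_le {f : ℝ → F} (hf : Continuous f) (u : ℝ) {ε : ℝ} (hε : 0 < ε) :
    ∀ᶠ m : ℕ in atTop, ∀ p ∈ Set.Icc 0 u, ∀ q ∈ Set.Icc 0 u, |p - q| ≤ u / m →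
      ‖f p - f q‖ ≤ ε := by
  have huc := isCompact_Icc.uniformContinuousOn_of_continuous (s := Set.Icc 0 u) hf.continuousOn
  obtain ⟨δ, hδ, h⟩ := Metric.uniformContinuousOn_iff.1 huc ε hε
  have hlim : Tendsto (fun m : ℕ => u / (m : ℝ)) atTop (nhds 0) :=
    tendsto_const_nhds.div_atTop tendsto_natCast_atTop_atTop
  filter_upwards [hlim.eventually (gt_mem_nhds hδ)] with m hm p hp q hq hpq
  rw [← dist_eq_norm]
  exact (h p hp q hq (by rw [Real.dist_eq]; linarith)).le

variable [NormedSpace ℝ F]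

lemma mesh_mem {u : ℝ} (hu : 0 ≤ u) {m i : ℕ} (hi : i ≤ m) :
    (i : ℝ) * (u / m) ∈ Set.Icc 0 u := by
  rcases m.eq_zero_or_pos with rfl | hm
  · simpa using hu
  have hm' : (0 : ℝ) < m := by exact_mod_cast hm
  have hi' : (i : ℝ) ≤ m := by exact_mod_cast hi
  refine ⟨by positivity, ?_⟩
  rw [mul_div_left_comm]
  exact mul_le_of_le_one_right hu ((div_le_one hm').2 hi')

lemma mesh_last {u : ℝ} {m : ℕ} (hm : 0 < m) : (m : ℝ) * (u / m) = u := by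
  have hm' : (m : ℝ) ≠ 0 := by exact_mod_cast hm.ne'
  field_simp

/-- Riemann sums with right end points. -/
lemma tendsto_riemannSum [CompleteSpace F] {u : ℝ} (hu : 0 ≤ u) {f : ℝ → F} (hf : Continuous f) :
    Tendsto (fun m : ℕ => ∑ i ∈ Finset.range m, (u / m) • f ((i + 1 : ℕ) * (u / m))) atTop
      (nhds (∫ r in (0 : ℝ)..u, f r)) := by
  have h0 : Tendsto (fun m : ℕ => ∑ i ∈ Finset.range m,
      ((u / m) • f ((i + 1 : ℕ) * (u / m))
        - ∫ r in ((i : ℕ) * (u / m))..((i + 1 : ℕ) * (u / m)), f r)) atTop (nhds 0) := by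
    refine tendsto_sum_of_forall_norm_le hu fun ε hε => ?_
    filter_upwards [eventually_norm_sub_le hf u hε] with m hm i hi
    have hlen : ((i + 1 : ℕ) : ℝ) * (u / m) - i * (u / m) = u / m := by push_cast; ring
    have hpos : 0 ≤ u / m := by positivity
    have hc : (u / m) • f ((i + 1 : ℕ) * (u / m))
        = ∫ r in ((i : ℕ) * (u / m))..((i + 1 : ℕ) * (u / m)), f ((i + 1 : ℕ) * (u / m)) := by
      rw [intervalIntegral.integral_const, hlen]
    rw [hc, ← intervalIntegral.integral_sub (by simp) (hf.intervalIntegrable _ _)]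
    refine (intervalIntegral.norm_integral_le_of_norm_le_const (C := ε) fun r hr => ?_).trans ?_
    · have hle : (i : ℝ) * (u / m) ≤ ((i + 1 : ℕ) : ℝ) * (u / m) := by linarith
      rw [Set.uIoc_of_le hle] at hr
      have h1 := mesh_mem hu (show i + 1 ≤ m from hi)
      have h2 := mesh_mem hu hi.le
      refine hm _ h1 _ ⟨h2.1.trans hr.1.le, hr.2.trans h1.2⟩ ?_
      rw [abs_of_nonneg (by linarith [hr.2])]
      linarith [hr.1]
    · rw [hlen, abs_of_nonneg hpos]
  have h1 : Tendsto (fun m : ℕ => ∑ i ∈ Finset.range m,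
      ∫ r in ((i : ℕ) * (u / m))..((i + 1 : ℕ) * (u / m)), f r) atTop
      (nhds (∫ r in (0 : ℝ)..u, f r)) := by
    refine tendsto_const_nhds.congr' ?_
    filter_upwards [eventually_gt_atTop 0] with m hm
    have := intervalIntegral.sum_integral_adjacent_intervals (f := f) (μ := volume)
      (a := fun i : ℕ => (i : ℝ) * (u / m)) (n := m) fun k _ => hf.intervalIntegrable _ _
    rw [this, mesh_last hm]
    simp
  have := h0.add h1
  simpa using this

variable [CompleteSpace F]

lemma continuous_exp_smul (a : F →L[ℝ] F) : Continuous fun r : ℝ => NormedSpace.exp (r • a) := by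
  rw [continuous_iff_continuousAt]
  exact fun r => (hasDerivAt_exp_smul_const (𝕂 := ℝ) a r).continuousAt

lemma exp_smul_add (a : F →L[ℝ] F) (r s : ℝ) :
    NormedSpace.exp ((r + s) • a) = NormedSpace.exp (r • a) * NormedSpace.exp (s • a) := by
  let _ : NormedAlgebra ℚ (F →L[ℝ] F) := NormedAlgebra.restrictScalars ℚ ℝ (F →L[ℝ] F)
  rw [add_smul]
  exact NormedSpace.exp_add_of_commute (((Commute.refl a).smul_left r).smul_right s)

/-- The Euler sum for the stochastic convolution `∫ e^{(u - r) a} b dv_r` over `[0, u]`. -/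
def eulerSum (a b : F →L[ℝ] F) (u : ℝ) (v : ℝ → F) (m : ℕ) : F :=
  ∑ i ∈ Finset.range m, NormedSpace.exp ((u - (i + 1 : ℕ) * (u / m)) • a)
    (b (v ((i + 1 : ℕ) * (u / m)) - v (i * (u / m))))

/-- For a path `y` driven by `v`, i.e. `dy = a y dr + b dv`, the Euler sums converge to
`y(u) - e^{u a} y(0)`. -/
lemma tendsto_eulerSum (a b : F →L[ℝ] F) {u : ℝ} (hu : 0 ≤ u) {y v : ℝ → F} (hy : Continuous y)
    (h : ∀ p q, 0 ≤ p → p ≤ q → q ≤ u → y q - y p = (∫ r in p..q, a (y r)) + b (v q - v p)) :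
    Tendsto (eulerSum a b u v) atTop (nhds (y u - NormedSpace.exp (u • a) (y 0))) := by
  set e : ℝ → F →L[ℝ] F := fun r => NormedSpace.exp (r • a) with he
  have hec : Continuous e := continuous_exp_smul a
  have he0 : e 0 = 1 := by simp [he]
  obtain ⟨E, hE⟩ := isCompact_Icc.exists_bound_of_continuousOn (s := Set.Icc 0 u) hec.continuousOn
  obtain ⟨Y, hY⟩ := isCompact_Icc.exists_bound_of_continuousOn (s := Set.Icc 0 u) hy.continuousOn
  have hE0 : 0 ≤ E := (norm_nonneg _).trans (hE 0 ⟨le_rfl, hu⟩)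
  have hY0 : 0 ≤ Y := (norm_nonneg _).trans (hY 0 ⟨le_rfl, hu⟩)
  -- The defect of one Euler step of length `h = u / m`: freezing the drift at the left end point,
  -- and replacing `e^{ha}` by `1 + ha`. Both are `o(h)` uniformly in `i`.
  let G : ℕ → ℕ → F := fun m i => e (u - (i + 1 : ℕ) * (u / m))
    (∫ r in ((i : ℕ) * (u / m))..((i + 1 : ℕ) * (u / m)), (a (y r) - a (y (i * (u / m)))))
    + e (u - (i + 1 : ℕ) * (u / m)) ((1 + (u / m) • a - e (u / m)) (y (i * (u / m))))
  have hG : Tendsto (fun m => ∑ i ∈ Finset.range m, G m i) atTop (nhds 0) := by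
    refine tendsto_sum_of_forall_norm_le hu fun ε hε => ?_
    have hlim : Tendsto (fun m : ℕ => u / (m : ℝ)) atTop (nhds 0) :=
      tendsto_const_nhds.div_atTop tendsto_natCast_atTop_atTop
    have hay : Continuous fun r => a (y r) := a.continuous.comp hy
    have hd : HasDerivAt e a 0 := by
      have := hasDerivAt_exp_smul_const (𝕂 := ℝ) a 0
      simpa using this
    -- The constants give each of the two defects a share of at most `ε / 2`; `E + 1` and `Y + 1`
    -- replace the bounds `E` and `Y` so that the divisors are positive.
    have ho := (hasDerivAt_iff_isLittleO_nhds_zero.1 hd).def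
      (c := ε / (2 * ((E + 1) * (Y + 1)))) (by positivity)
    filter_upwards [eventually_norm_sub_le hay u (ε := ε / (2 * (E + 1))) (by positivity),
      hlim.eventually ho] with m hm hm' i hi
    have hlen : ((i + 1 : ℕ) : ℝ) * (u / m) - i * (u / m) = u / m := by push_cast; ring
    have hpos : 0 ≤ u / m := by positivity
    have h1 := mesh_mem hu (show i + 1 ≤ m from hi)
    have h2 := mesh_mem hu hi.le
    have hle : (i : ℝ) * (u / m) ≤ ((i + 1 : ℕ) : ℝ) * (u / m) := by linarith
    have hEi : ‖e (u - (i + 1 : ℕ) * (u / m))‖ ≤ E := hE _ ⟨by linarith [h1.2], by linarith [h1.1]⟩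
    have hI : ‖∫ r in ((i : ℕ) * (u / m))..((i + 1 : ℕ) * (u / m)),
        (a (y r) - a (y (i * (u / m))))‖ ≤ ε / (2 * (E + 1)) * (u / m) := by
      refine (intervalIntegral.norm_integral_le_of_norm_le_const fun r hr => ?_).trans
        (by rw [hlen, abs_of_nonneg hpos])
      rw [Set.uIoc_of_le hle] at hr
      refine hm _ ⟨h2.1.trans hr.1.le, hr.2.trans h1.2⟩ _ h2 ?_
      rw [abs_of_nonneg (by linarith [hr.1])]
      linarith [hr.2]
    have hD : ‖(1 + (u / m) • a - e (u / m)) (y (i * (u / m)))‖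
        ≤ ε / (2 * ((E + 1) * (Y + 1))) * (u / m) * Y := by
      refine (ContinuousLinearMap.le_opNorm _ _).trans ?_
      refine mul_le_mul ?_ (hY _ h2) (norm_nonneg _) (by positivity)
      rw [zero_add, he0, Real.norm_of_nonneg hpos] at hm'
      rw [← norm_neg]
      refine le_trans (le_of_eq ?_) hm'
      congr 1
      abel
    calc ‖G m i‖ ≤ E * (ε / (2 * (E + 1)) * (u / m))
          + E * (ε / (2 * ((E + 1) * (Y + 1))) * (u / m) * Y) := by
          refine (norm_add_le _ _).trans (add_le_add ?_ ?_)
          · exact (ContinuousLinearMap.le_opNorm _ _).trans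
              (mul_le_mul hEi hI (norm_nonneg _) hE0)
          · exact (ContinuousLinearMap.le_opNorm _ _).trans
              (mul_le_mul hEi hD (norm_nonneg _) hE0)
      _ = (E / (E + 1)) * (ε / 2) * (u / m)
          + (E / (E + 1)) * (Y / (Y + 1)) * (ε / 2) * (u / m) := by
          field_simp
      _ ≤ 1 * (ε / 2) * (u / m) + 1 * 1 * (ε / 2) * (u / m) := by
          have hE1 : E / (E + 1) ≤ 1 := (div_le_one (by linarith)).2 (by linarith)
          have hY1 : Y / (Y + 1) ≤ 1 := (div_le_one (by linarith)).2 (by linarith)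
          gcongr
      _ = ε * (u / m) := by ring
  -- Telescope `e^{(u - r) a} y(r)` along the mesh: each increment is the Euler term plus the defect
  -- `G m i`. At `m = 0` the mesh does not reach `u`, hence the restriction to large `m`.
  have hsum : ∀ᶠ m : ℕ in atTop, y u - e u (y 0) - ∑ i ∈ Finset.range m, G m i
      = eulerSum a b u v m := by
    filter_upwards [eventually_gt_atTop 0] with m hm
    have htel := Finset.sum_range_sub
      (fun i : ℕ => e (u - i * (u / m)) (y (i * (u / m)))) m
    rw [mesh_last hm, sub_self, he0] at htel
    have htel' : y u - e u (y 0) = ∑ i ∈ Finset.range m,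
        (e (u - (i + 1 : ℕ) * (u / m)) (y ((i + 1 : ℕ) * (u / m)))
          - e (u - i * (u / m)) (y (i * (u / m)))) := by
      rw [htel]
      simp
    rw [htel', ← Finset.sum_sub_distrib, eulerSum]
    refine Finset.sum_congr rfl fun i hi => ?_
    have hi := Finset.mem_range.1 hi
    have h1 := mesh_mem hu (show i + 1 ≤ m from hi)
    have h2 := mesh_mem hu hi.le
    have hlen : ((i + 1 : ℕ) : ℝ) * (u / m) - i * (u / m) = u / m := by push_cast; ring
    have hpos : 0 ≤ u / m := by positivity
    have hstep := h _ _ h2.1 (show (i : ℝ) * (u / m) ≤ (i + 1 : ℕ) * (u / m) by linarith) h1.2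
    have hint : ∫ r in ((i : ℕ) * (u / m))..((i + 1 : ℕ) * (u / m)),
        (a (y r) - a (y (i * (u / m))))
        = (∫ r in ((i : ℕ) * (u / m))..((i + 1 : ℕ) * (u / m)), a (y r))
          - (u / m) • a (y (i * (u / m))) := by
      have hay : Continuous fun r => a (y r) := a.continuous.comp hy
      rw [intervalIntegral.integral_sub (hay.intervalIntegrable _ _) intervalIntegrable_const,
        intervalIntegral.integral_const, hlen]
    have hexp : e (u - i * (u / m)) = e (u - (i + 1 : ℕ) * (u / m)) * e (u / m) := by
      simp only [he]
      rw [← exp_smul_add]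
      congr 2
      push_cast
      ring
    have hb : b (v ((i + 1 : ℕ) * (u / m)) - v (i * (u / m)))
        = y ((i + 1 : ℕ) * (u / m)) - y (i * (u / m))
          - ∫ r in ((i : ℕ) * (u / m))..((i + 1 : ℕ) * (u / m)), a (y r) := by
      rw [hstep]; abel
    show _ = e (u - (i + 1 : ℕ) * (u / m)) _
    simp only [G]
    rw [hb, hint, hexp]
    simp only [mul_apply_eq_comp, _root_.sub_apply,
      _root_.add_apply, one_apply_eq_self,
      _root_.smul_apply, map_sub, map_add]
    abel
  refine Tendsto.congr' hsum ?_
  simpa using tendsto_const_nhds.sub hG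

end Euler

/-! ### Matrices: exponentials and integrals -/

section Matrices

variable {n : ℕ}

lemma toEuclideanCLM_expA (A : Matrix (Fin n) (Fin n) ℝ) (s : ℝ) :
    Matrix.toEuclideanCLM (𝕜 := ℝ) (expA A s)
      = NormedSpace.exp (s • Matrix.toEuclideanCLM (𝕜 := ℝ) A) := by
  open scoped Matrix.Norms.Operator in
  let _ : NormedAlgebra ℚ (Matrix (Fin n) (Fin n) ℝ) := NormedAlgebra.restrictScalars ℚ ℝ _
  have hc : Continuous (Matrix.toEuclideanCLM (𝕜 := ℝ) : Matrix (Fin n) (Fin n) ℝ → _) :=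
    LinearMap.continuous_of_finiteDimensional
      (Matrix.toEuclideanCLM (n := Fin n) (𝕜 := ℝ)).toAlgEquiv.toLinearMap
  have h := NormedSpace.map_exp (Matrix.toEuclideanCLM (n := Fin n) (𝕜 := ℝ)) hc (s • A)
  rw [← map_smul]
  exact h

lemma expA_transpose (A : Matrix (Fin n) (Fin n) ℝ) (s : ℝ) : expA Aᵀ s = (expA A s)ᵀ := by
  rw [expA, expA, ← Matrix.transpose_smul, Matrix.exp_transpose]

lemma continuous_expA (A : Matrix (Fin n) (Fin n) ℝ) : Continuous (expA A) := by
  have h : expA A = fun s => (Matrix.toEuclideanCLM (n := Fin n) (𝕜 := ℝ)).symm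
      (NormedSpace.exp (s • Matrix.toEuclideanCLM (𝕜 := ℝ) A)) := by
    funext s
    rw [← toEuclideanCLM_expA]
    simp
  rw [h]
  exact (LinearMap.continuous_of_finiteDimensional
    (Matrix.toEuclideanCLM (n := Fin n) (𝕜 := ℝ)).symm.toAlgEquiv.toLinearMap).comp
      (continuous_exp_smul _)

/-- The quadratic form of an entrywise integral. -/
lemma dotProduct_integral_mulVec {M : ℝ → Matrix (Fin n) (Fin n) ℝ} (hM : Continuous M)
    (s : ℝ) (v : Fin n → ℝ) :
    v ⬝ᵥ (Matrix.of fun i j => ∫ r in (0 : ℝ)..s, M r i j) *ᵥ v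
      = ∫ r in (0 : ℝ)..s, v ⬝ᵥ M r *ᵥ v := by
  have hij : ∀ i j, Continuous fun r => M r i j := fun i j => hM.matrix_elem i j
  simp only [dotProduct, Matrix.mulVec, Matrix.of_apply]
  rw [intervalIntegral.integral_finsetSum fun i _ =>
    Continuous.intervalIntegrable (by fun_prop) _ _]
  refine Finset.sum_congr rfl fun i _ => ?_
  rw [intervalIntegral.integral_const_mul, intervalIntegral.integral_finsetSum fun j _ =>
    Continuous.intervalIntegrable (by fun_prop) _ _]
  simp_rw [intervalIntegral.integral_mul_const]

lemma dotProduct_mul_transpose_mulVec (M : Matrix (Fin n) (Fin n) ℝ) (v : Fin n → ℝ) :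
    v ⬝ᵥ (M * Mᵀ) *ᵥ v = (Mᵀ *ᵥ v) ⬝ᵥ (Mᵀ *ᵥ v) := by
  rw [← Matrix.mulVec_mulVec, Matrix.dotProduct_mulVec, ← Matrix.mulVec_transpose]

lemma norm_sq_toEuclideanCLM (M : Matrix (Fin n) (Fin n) ℝ) (v : Vec n) :
    ‖Matrix.toEuclideanCLM (𝕜 := ℝ) M v‖ ^ 2 = v.ofLp ⬝ᵥ (Mᵀ * M) *ᵥ v.ofLp := by
  have h := dotProduct_mul_transpose_mulVec Mᵀ v.ofLp
  rw [Matrix.transpose_transpose] at h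
  rw [h, EuclideanSpace.real_norm_sq_eq, Matrix.ofLp_toEuclideanCLM, dotProduct]
  simp_rw [sq]

lemma noiseCov_integrand (A B : Matrix (Fin n) (Fin n) ℝ) (r : ℝ) :
    expA A r * B * Bᵀ * expA Aᵀ r = (expA A r * B) * (expA A r * B)ᵀ := by
  rw [expA_transpose, Matrix.transpose_mul, Matrix.mul_assoc, Matrix.mul_assoc]

lemma continuous_noiseCov_integrand (A B : Matrix (Fin n) (Fin n) ℝ) :
    Continuous fun r => (expA A r * B) * (expA A r * B)ᵀ := by
  have h := continuous_expA A
  fun_prop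

lemma dotProduct_noiseCov_mulVec (A B : Matrix (Fin n) (Fin n) ℝ) (s : ℝ) (v : Vec n) :
    v.ofLp ⬝ᵥ noiseCov A B s *ᵥ v.ofLp
      = ∫ r in (0 : ℝ)..s, ‖Matrix.toEuclideanCLM (𝕜 := ℝ) (expA A r * B)ᵀ v‖ ^ 2 := by
  simp only [noiseCov, noiseCov_integrand]
  rw [dotProduct_integral_mulVec (continuous_noiseCov_integrand A B)]
  simp_rw [norm_sq_toEuclideanCLM, Matrix.transpose_transpose]

lemma posSemidef_noiseCov (A B : Matrix (Fin n) (Fin n) ℝ) {s : ℝ} (hs : 0 ≤ s) :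
    (noiseCov A B s).PosSemidef := by
  refine Matrix.posSemidef_iff_dotProduct_mulVec.2 ⟨?_, fun v => ?_⟩
  · ext i j
    simp only [noiseCov, noiseCov_integrand, Matrix.conjTranspose_apply, Matrix.of_apply,
      star_trivial]
    refine intervalIntegral.integral_congr fun r _ => ?_
    rw [← Matrix.transpose_apply ((expA A r * B) * (expA A r * B)ᵀ), Matrix.transpose_mul,
      Matrix.transpose_transpose]
  · have h := dotProduct_noiseCov_mulVec A B s (WithLp.toLp 2 v)
    simp only [star_trivial]
    rw [h]
    exact intervalIntegral.integral_nonneg hs fun r _ => by positivity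

lemma noiseRoot_mul_transpose (A B : Matrix (Fin n) (Fin n) ℝ) {s : ℝ} (hs : 0 ≤ s) :
    noiseRoot A B s * (noiseRoot A B s)ᵀ = noiseCov A B s := by
  have h0 := (posSemidef_noiseCov A B hs).nonneg
  have hsa : (noiseRoot A B s)ᵀ = noiseRoot A B s := by
    have h1 : (noiseRoot A B s).PosSemidef :=
      Matrix.nonneg_iff_posSemidef.1 (CFC.sqrt_nonneg _)
    have h2 := h1.isHermitian
    rwa [Matrix.IsHermitian, Matrix.conjTranspose_eq_transpose_of_trivial] at h2
  rw [hsa]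
  exact CFC.sqrt_mul_sqrt_self _ h0

lemma trace_noiseCov_nonneg (A B : Matrix (Fin n) (Fin n) ℝ) {s : ℝ} (hs : 0 ≤ s) :
    0 ≤ (noiseCov A B s).trace :=
  (posSemidef_noiseCov A B hs).trace_nonneg

lemma continuous_trace_noiseCov (A B : Matrix (Fin n) (Fin n) ℝ) :
    Continuous fun s => (noiseCov A B s).trace := by
  have hij : ∀ i j, Continuous fun r => ((expA A r * B) * (expA A r * B)ᵀ) i j := fun i j =>
    (continuous_noiseCov_integrand A B).matrix_elem i j
  simp only [noiseCov, noiseCov_integrand, Matrix.trace, Matrix.diag, Matrix.of_apply]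
  exact continuous_finsetSum _ fun i _ => intervalIntegral.continuous_primitive
    (fun _ _ => (hij i i).intervalIntegrable _ _) 0

lemma continuous_noiseCov_apply (A B : Matrix (Fin n) (Fin n) ℝ) (i j : Fin n) :
    Continuous fun s => noiseCov A B s i j := by
  have hij : Continuous fun r => ((expA A r * B) * (expA A r * B)ᵀ) i j :=
    (continuous_noiseCov_integrand A B).matrix_elem i j
  simp only [noiseCov, noiseCov_integrand, Matrix.of_apply]
  exact intervalIntegral.continuous_primitive (fun _ _ => hij.intervalIntegrable _ _) 0

lemma bBar_eq (A B : Matrix (Fin n) (Fin n) ℝ) {τ : ℝ} (hτ : 0 ≤ τ) :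
    bBar A B τ = ∫ t in (0 : ℝ)..τ, (noiseCov A B t).trace := by
  simp only [bBar, Matrix.trace, Matrix.diag, Matrix.of_apply]
  rw [intervalIntegral.integral_finsetSum fun i _ =>
    (continuous_noiseCov_apply A B i i).intervalIntegrable _ _]
  refine Finset.sum_congr rfl fun i _ => intervalIntegral.integral_congr fun t ht => ?_
  rw [Set.uIcc_of_le hτ] at ht
  rw [noiseRoot_mul_transpose A B ht.1]

/-- The reason for the weight `Q̄`: it accumulates over one period the error made at the sampling
time and propagated by the drift. -/
lemma weightedSq_Qbar (A : Matrix (Fin n) (Fin n) ℝ) {τ : ℝ} (hτ : 0 ≤ τ) (v : Vec n) :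
    weightedSq (Qbar A τ) v
      = ∫⁻ t in Set.Ioc 0 τ, ‖Matrix.toEuclideanCLM (𝕜 := ℝ) (expA A t) v‖ₑ ^ 2 := by
  have hc := continuous_expA A
  have hcont : Continuous fun t => (expA A t)ᵀ * expA A t := by fun_prop
  have h1 : v.ofLp ⬝ᵥ Qbar A τ *ᵥ v.ofLp
      = ∫ t in (0 : ℝ)..τ, ‖Matrix.toEuclideanCLM (𝕜 := ℝ) (expA A t) v‖ ^ 2 := by
    simp only [Qbar, expA_transpose]
    rw [dotProduct_integral_mulVec hcont]
    simp_rw [norm_sq_toEuclideanCLM]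
  have h2 : Continuous fun t => ‖Matrix.toEuclideanCLM (𝕜 := ℝ) (expA A t) v‖ ^ 2 := by
    simp_rw [toEuclideanCLM_expA]
    have := continuous_exp_smul (Matrix.toEuclideanCLM (𝕜 := ℝ) A)
    fun_prop
  rw [weightedSq, h1, intervalIntegral.integral_of_le hτ,
    ofReal_integral_eq_lintegral_ofReal (h2.integrableOn_Ioc) (ae_of_all _ fun t => by positivity)]
  refine lintegral_congr fun t => ?_
  rw [ENNReal.ofReal_pow (norm_nonneg _), ofReal_norm]

end Matrices

/-! ### Gaussian increments -/

section Brownian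

variable {Ω : Type*} [MeasurableSpace Ω] {P : Measure Ω} {n : ℕ} {W : ℝ≥0 → Ω → Vec n}

/-- The weak Markov property in `ℝⁿ`. -/
lemma IsStdBrownian.indepFun_shift [IsProbabilityMeasure P] (hW : IsStdBrownian P W) (s : ℝ≥0) :
    IndepFun (fun ω (r : ℝ≥0) => W (s + r) ω - W s ω) (fun ω (r : Set.Iic s) => W r ω) P := by
  have hm := hW.measurable
  have hi : iIndepFun (fun i ω => ((fun r : ℝ≥0 => W (s + r) ω i - W s ω i),
      (fun r : Set.Iic s => W r ω i))) P :=
    hW.indep.comp (fun _ w => ((fun r : ℝ≥0 => w (s + r) - w s), (fun r : Set.Iic s => w r)))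
      fun _ => by fun_prop
  have h := indepFun_pi_of_iIndepFun_prodMk (fun i => by fun_prop) (fun i => by fun_prop) hi
    fun i => (hW.brownian i).toIsPreBrownianReal.indepFun_shift s
  exact h.comp (φ := fun f (r : ℝ≥0) => (WithLp.toLp 2 fun i => f i r : Vec n))
    (ψ := fun f (r : Set.Iic s) => (WithLp.toLp 2 fun i => f i r : Vec n))
    (by fun_prop) (by fun_prop)

lemma IsStdBrownian.charFun_sub [IsProbabilityMeasure P] (hW : IsStdBrownian P W) {s t : ℝ≥0}
    (hst : s ≤ t) (ξ : Vec n) :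
    charFun (P.map fun ω => W t ω - W s ω) ξ
      = Complex.exp (-(((t : ℝ) - s) * ‖ξ‖ ^ 2 / 2 : ℝ)) := by
  have hm := hW.measurable
  have hi : iIndepFun (fun i ω => W t ω i - W s ω i) P :=
    hW.indep.comp (fun _ w => w t - w s) fun _ => by fun_prop
  have h := (iIndepFun_iff_charFun_pi fun i => by fun_prop).1 hi ξ
  refine h.trans ?_
  have hg : ∀ i, P.map (fun ω => W t ω i - W s ω i) = gaussianReal 0 (nndist (t : ℝ) s) :=
    fun i => ((hW.brownian i).toIsPreBrownianReal.hasLaw_sub t s).map_eq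
  have hd : ((nndist (t : ℝ) s : ℝ≥0) : ℝ) = t - s := by
    rw [coe_nndist, Real.dist_eq, abs_of_nonneg (sub_nonneg.2 (by exact_mod_cast hst))]
  simp_rw [hg, charFun_gaussianReal, hd]
  rw [← Complex.exp_sum, EuclideanSpace.real_norm_sq_eq]
  congr 1
  push_cast
  rw [Finset.mul_sum, Finset.sum_div, ← Finset.sum_neg_distrib]
  refine Finset.sum_congr rfl fun i _ => ?_
  ring

lemma charFun_map_clm {μ : Measure (Vec n)} (c : Vec n →L[ℝ] Vec n) (ξ : Vec n) :
    charFun (μ.map c) ξ = charFun μ (ContinuousLinearMap.adjoint c ξ) := by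
  rw [charFun_apply, charFun_apply, integral_map (by fun_prop)
    (Continuous.aestronglyMeasurable (by fun_prop))]
  simp_rw [ContinuousLinearMap.adjoint_inner_right]

/-- The Wiener integral of a step function. The last increment is independent of the earlier ones by
the weak Markov property at `t m`, so the characteristic functions multiply. -/
lemma IsStdBrownian.charFun_sum [IsProbabilityMeasure P] (hW : IsStdBrownian P W) {t : ℕ → ℝ≥0}
    (ht : Monotone t) (c : ℕ → Vec n →L[ℝ] Vec n) (m : ℕ) (ξ : Vec n) :
    charFun (P.map fun ω => ∑ i ∈ Finset.range m, c i (W (t (i + 1)) ω - W (t i) ω)) ξ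
      = Complex.exp (-((∑ i ∈ Finset.range m, ((t (i + 1) : ℝ) - t i)
          * ‖ContinuousLinearMap.adjoint (c i) ξ‖ ^ 2) / 2 : ℝ)) := by
  have hm := hW.measurable
  induction m with
  | zero => simp [Measure.map_const]
  | succ m ih =>
    have hind : IndepFun
        (fun ω => ∑ i ∈ Finset.range m, c i (W (t (i + 1)) ω - W (t i) ω))
        (fun ω => c m (W (t (m + 1)) ω - W (t m) ω)) P := by
      have h := (hW.indepFun_shift (t m)).symm
      have h2 := h.comp
        (φ := fun w => ∑ i : Fin m,
          c i (w ⟨t (i + 1), ht i.isLt⟩ - w ⟨t i, ht i.isLt.le⟩))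
        (ψ := fun v => c m (v (t (m + 1) - t m))) (by fun_prop) (by fun_prop)
      convert h2 using 1
      · funext ω
        exact (Fin.sum_univ_eq_sum_range
          (fun i => c i (W (t (i + 1)) ω - W (t i) ω)) m).symm
      · funext ω
        simp [add_tsub_cancel_of_le (ht (Nat.le_succ m))]
    simp_rw [Finset.sum_range_succ]
    rw [hind.charFun_map_fun_add_eq_mul (by fun_prop) (by fun_prop), Pi.mul_apply, ih]
    have hlast : charFun (P.map fun ω => c m (W (t (m + 1)) ω - W (t m) ω)) ξ
        = Complex.exp (-(((t (m + 1) : ℝ) - t m)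
          * ‖ContinuousLinearMap.adjoint (c m) ξ‖ ^ 2 / 2 : ℝ)) := by
      have hmm : P.map (fun ω => c m (W (t (m + 1)) ω - W (t m) ω))
          = (P.map fun ω => W (t (m + 1)) ω - W (t m) ω).map (c m) := by
        rw [Measure.map_map (by fun_prop) (by fun_prop)]
        rfl
      rw [hmm, charFun_map_clm, hW.charFun_sub (ht (Nat.le_succ m))]
    rw [hlast, ← Complex.exp_add]
    congr 1
    push_cast
    ring

lemma tendsto_charFun_of_tendsto_ae [IsProbabilityMeasure P] {f : ℕ → Ω → Vec n}
    {g : Ω → Vec n} (hf : ∀ m, Measurable (f m)) (hg : Measurable g)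
    (h : ∀ᵐ ω ∂P, Tendsto (fun m => f m ω) atTop (nhds (g ω))) (ξ : Vec n) :
    Tendsto (fun m => charFun (P.map (f m)) ξ) atTop (nhds (charFun (P.map g) ξ)) := by
  have hc : Continuous fun x : Vec n => Complex.exp ((inner ℝ x ξ : ℝ) * Complex.I) := by
    fun_prop
  have hcf : ∀ k : Ω → Vec n, Measurable k →
      charFun (P.map k) ξ = ∫ ω, Complex.exp ((inner ℝ (k ω) ξ : ℝ) * Complex.I) ∂P :=
    fun k hk => by
      rw [charFun_apply, integral_map hk.aemeasurable hc.aestronglyMeasurable]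
  simp_rw [hcf _ hg, fun m => hcf _ (hf m)]
  refine tendsto_integral_of_dominated_convergence (fun _ => 1)
    (fun m => (hc.measurable.comp (hf m)).aestronglyMeasurable) (integrable_const _)
    (fun m => ae_of_all _ fun ω => ?_) ?_
  · rw [Complex.norm_exp_ofReal_mul_I]
  · filter_upwards [h] with ω hω using (hc.tendsto _).comp hω

end Brownian

/-! ### The continuous-time source over one sampling period -/

section Solution

variable {Ω : Type*} [MeasurableSpace Ω] {P : Measure Ω} {n : ℕ} {W X : ℝ≥0 → Ω → Vec n}
  {A B S₀ : Matrix (Fin n) (Fin n) ℝ}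

lemma IsSolution.indepFun_past_future [IsProbabilityMeasure P] (hX : IsSolution P A B S₀ W X)
    (s : ℝ≥0) :
    IndepFun (fun ω => (X 0 ω, fun r : Set.Iic s => W r ω))
      (fun ω (r : ℝ≥0) => W (s + r) ω - W s ω) P := by
  have hm := hX.brownian.measurable
  refine indepFun_prodMk_left (hX.measurable 0) (by fun_prop) (by fun_prop) ?_
    (hX.brownian.indepFun_shift s).symm
  exact hX.indep.comp (φ := id)
    (ψ := fun w => ((fun r : Set.Iic s => w r), fun r : ℝ≥0 => w (s + r) - w s))
    measurable_id (by fun_prop)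

/-- The part of `X_{s + u}` that is produced by the noise on `[s, s + u]`. -/
def accumulatedNoise (A : Matrix (Fin n) (Fin n) ℝ) (X : ℝ≥0 → Ω → Vec n) (s u : ℝ≥0) (ω : Ω) :
    Vec n :=
  X (s + u) ω - Matrix.toEuclideanCLM (𝕜 := ℝ) (expA A u) (X s ω)

lemma IsSolution.measurable_accumulatedNoise (hX : IsSolution P A B S₀ W X) (s u : ℝ≥0) :
    Measurable (accumulatedNoise A X s u) := by
  have := hX.measurable
  unfold accumulatedNoise
  fun_prop

/-- The path restarted at time `s` solves the same equation driven by `W (s + ·) - W s`, so the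
accumulated noise is a limit of functions of the increments after `s` alone. -/
lemma IsSolution.tendsto_eulerSum (hX : IsSolution P A B S₀ W X) (s u : ℝ≥0) :
    ∀ᵐ ω ∂P, Tendsto (eulerSum (Matrix.toEuclideanCLM (𝕜 := ℝ) A)
      (Matrix.toEuclideanCLM (𝕜 := ℝ) B) u (fun r => W (s + r.toNNReal) ω - W s ω)) atTop
      (nhds (accumulatedNoise A X s u ω)) := by
  filter_upwards [hX.continuous, hX.equation] with ω hc he
  have hcr : Continuous fun r : ℝ => X r.toNNReal ω := hc.comp continuous_real_toNNReal
  have hy : Continuous fun r : ℝ => X (s + r.toNNReal) ω :=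
    hc.comp (continuous_const.add continuous_real_toNNReal)
  have hac : Continuous fun r : ℝ => Matrix.toEuclideanCLM (𝕜 := ℝ) A (X r.toNNReal ω) :=
    (Matrix.toEuclideanCLM (𝕜 := ℝ) A).continuous.comp hcr
  have h := CausalCoding.tendsto_eulerSum (Matrix.toEuclideanCLM (𝕜 := ℝ) A)
    (Matrix.toEuclideanCLM (𝕜 := ℝ) B) u.coe_nonneg hy
    (v := fun r => W (s + r.toNNReal) ω - W s ω) ?_
  · simpa [accumulatedNoise, toEuclideanCLM_expA] using h
  · intro p q hp hpq _
    have hq := hp.trans hpq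
    have e1 := he (s + q.toNNReal)
    have e2 := he (s + p.toNNReal)
    simp only [NNReal.coe_add, Real.coe_toNNReal _ hp, Real.coe_toNNReal _ hq] at e1 e2
    have hsub := intervalIntegral.integral_interval_sub_left
      (hac.intervalIntegrable (μ := volume) 0 (s + q)) (hac.intervalIntegrable 0 (s + p))
    have hshift : ∫ r in p..q, Matrix.toEuclideanCLM (𝕜 := ℝ) A (X (s + r.toNNReal) ω)
        = ∫ r in ((s : ℝ) + p)..(s + q), Matrix.toEuclideanCLM (𝕜 := ℝ) A (X r.toNNReal ω) := by
      rw [← intervalIntegral.integral_comp_add_left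
        (fun r => Matrix.toEuclideanCLM (𝕜 := ℝ) A (X r.toNNReal ω)) (s : ℝ)]
      refine intervalIntegral.integral_congr fun r hr => ?_
      rw [Set.uIcc_of_le hpq] at hr
      rw [Real.toNNReal_add s.coe_nonneg (hp.trans hr.1), Real.toNNReal_coe]
    rw [hshift, ← hsub]
    simp only [e1, e2, sub_sub_sub_cancel_right, map_sub]
    abel

lemma mesh_toNNReal_monotone (u : ℝ≥0) (s : ℝ≥0) (m : ℕ) :
    Monotone fun i : ℕ => s + ((i : ℝ) * ((u : ℝ) / m)).toNNReal := by
  intro i j hij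
  have : (i : ℝ) ≤ j := by exact_mod_cast hij
  simp only
  gcongr

lemma measurable_eulerSum {Ω' : Type*} [MeasurableSpace Ω'] (a b : Vec n →L[ℝ] Vec n) (u : ℝ)
    {v : ℝ → Ω' → Vec n} (hv : ∀ r, Measurable (v r)) (m : ℕ) :
    Measurable fun ω => eulerSum a b u (fun r => v r ω) m := by
  unfold eulerSum
  refine Finset.measurable_sum _ fun i _ => ?_
  exact (ContinuousLinearMap.measurable _).comp
    (b.measurable.comp ((hv _).sub (hv _)))

lemma adjoint_exp_mul_toEuclideanCLM (A B : Matrix (Fin n) (Fin n) ℝ) (r : ℝ) :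
    ContinuousLinearMap.adjoint (NormedSpace.exp (r • Matrix.toEuclideanCLM (𝕜 := ℝ) A)
        * Matrix.toEuclideanCLM (𝕜 := ℝ) B)
      = Matrix.toEuclideanCLM (𝕜 := ℝ) (expA A r * B)ᵀ := by
  rw [← toEuclideanCLM_expA, ← map_mul, ← ContinuousLinearMap.star_eq_adjoint,
    ← map_star, Matrix.star_eq_conjTranspose, Matrix.conjTranspose_eq_transpose_of_trivial]

lemma IsStdBrownian.charFun_eulerSum [IsProbabilityMeasure P] (hW : IsStdBrownian P W)
    (A B : Matrix (Fin n) (Fin n) ℝ) (s u : ℝ≥0) (m : ℕ) (ξ : Vec n) :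
    charFun (P.map fun ω => eulerSum (Matrix.toEuclideanCLM (𝕜 := ℝ) A)
        (Matrix.toEuclideanCLM (𝕜 := ℝ) B) u (fun r => W (s + r.toNNReal) ω - W s ω) m) ξ
      = Complex.exp (-((∑ i ∈ Finset.range m, ((u : ℝ) / m) •
          ‖Matrix.toEuclideanCLM (𝕜 := ℝ) (expA A (u - (i + 1 : ℕ) * (u / m)) * B)ᵀ ξ‖ ^ 2)
            / 2 : ℝ)) := by
  have hsum := hW.charFun_sum (mesh_toNNReal_monotone u s m)
    (fun i => (NormedSpace.exp (((u : ℝ) - (i + 1 : ℕ) * (u / m))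
      • Matrix.toEuclideanCLM (𝕜 := ℝ) A)) * Matrix.toEuclideanCLM (𝕜 := ℝ) B) m ξ
  have hfun : (fun ω => eulerSum (Matrix.toEuclideanCLM (𝕜 := ℝ) A)
      (Matrix.toEuclideanCLM (𝕜 := ℝ) B) u (fun r => W (s + r.toNNReal) ω - W s ω) m)
      = fun ω => ∑ i ∈ Finset.range m,
        ((NormedSpace.exp (((u : ℝ) - (i + 1 : ℕ) * (u / m))
          • Matrix.toEuclideanCLM (𝕜 := ℝ) A)) * Matrix.toEuclideanCLM (𝕜 := ℝ) B)
          (W (s + (((i + 1 : ℕ) : ℝ) * ((u : ℝ) / m)).toNNReal) ω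
            - W (s + ((i : ℝ) * ((u : ℝ) / m)).toNNReal) ω) := by
    funext ω
    refine Finset.sum_congr rfl fun i _ => ?_
    rw [mul_apply_eq_comp, sub_sub_sub_cancel_right]
  have hterm : ∀ i : ℕ, (((s + (((i + 1 : ℕ) : ℝ) * ((u : ℝ) / m)).toNNReal : ℝ≥0) : ℝ)
      - (s + ((i : ℝ) * ((u : ℝ) / m)).toNNReal : ℝ≥0)) = (u : ℝ) / m := fun i => by
    rw [NNReal.coe_add, NNReal.coe_add, Real.coe_toNNReal _ (by positivity),
      Real.coe_toNNReal _ (by positivity)]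
    push_cast
    ring
  rw [hfun, hsum]
  simp_rw [hterm, adjoint_exp_mul_toEuclideanCLM, smul_eq_mul]

/-- The Euler sums are Gaussian, with variances in direction `ξ` that are Riemann sums of the
quadratic form of `noiseCov`; almost sure convergence identifies the limit of their characteristic
functions. -/
lemma IsSolution.map_accumulatedNoise [IsProbabilityMeasure P] (hX : IsSolution P A B S₀ W X)
    (s u : ℝ≥0) :
    P.map (accumulatedNoise A X s u) = multivariateGaussian 0 (noiseCov A B u) := by
  have hm := hX.brownian.measurable
  have hN := hX.measurable_accumulatedNoise s u
  have : IsProbabilityMeasure (P.map (accumulatedNoise A X s u)) :=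
    Measure.isProbabilityMeasure_map hN.aemeasurable
  refine Measure.ext_of_charFun (funext fun ξ => ?_)
  have hmeas : ∀ m, Measurable fun ω => eulerSum (Matrix.toEuclideanCLM (𝕜 := ℝ) A)
      (Matrix.toEuclideanCLM (𝕜 := ℝ) B) u (fun r => W (s + r.toNNReal) ω - W s ω) m := fun m =>
    measurable_eulerSum _ _ u (fun r => (hm _).sub (hm s)) m
  refine tendsto_nhds_unique
    (tendsto_charFun_of_tendsto_ae hmeas hN (hX.tendsto_eulerSum s u) ξ) ?_
  have hfc : Continuous fun r => ‖Matrix.toEuclideanCLM (𝕜 := ℝ) (expA A r * B)ᵀ ξ‖ ^ 2 := by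
    have h := continuous_expA A
    simp only [norm_sq_toEuclideanCLM]
    have : Continuous fun r => ((expA A r * B)ᵀᵀ * (expA A r * B)ᵀ) := by fun_prop
    exact continuous_const.dotProduct (this.matrix_mulVec continuous_const)
  have hR := tendsto_riemannSum u.coe_nonneg
    (f := fun r => ‖Matrix.toEuclideanCLM (𝕜 := ℝ) (expA A (u - r) * B)ᵀ ξ‖ ^ 2)
    (hfc.comp (continuous_const.sub continuous_id))
  -- Noise injected at time `r` is propagated for the remaining time `u - r`; the reflection `r ↦ u
  -- - r` brings the integral to the form of `noiseCov`.
  have hI : ∫ r in (0 : ℝ)..u, ‖Matrix.toEuclideanCLM (𝕜 := ℝ) (expA A (u - r) * B)ᵀ ξ‖ ^ 2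
      = ξ.ofLp ⬝ᵥ noiseCov A B u *ᵥ ξ.ofLp := by
    rw [dotProduct_noiseCov_mulVec, intervalIntegral.integral_comp_sub_left
      (fun r => ‖Matrix.toEuclideanCLM (𝕜 := ℝ) (expA A r * B)ᵀ ξ‖ ^ 2) (u : ℝ),
      sub_self, sub_zero]
  rw [hI] at hR
  rw [charFun_multivariateGaussian (posSemidef_noiseCov A B u.coe_nonneg)]
  have hcont : Continuous fun x : ℝ => Complex.exp (-((x / 2 : ℝ) : ℂ)) := by fun_prop
  have hlim := (hcont.tendsto _).comp hR
  have hval : Complex.exp ((inner ℝ ξ (0 : Vec n) : ℝ) * Complex.I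
      - ((ξ.ofLp ⬝ᵥ noiseCov A B u *ᵥ ξ.ofLp : ℝ) : ℂ) / 2)
      = Complex.exp (-((ξ.ofLp ⬝ᵥ noiseCov A B u *ᵥ ξ.ofLp / 2 : ℝ) : ℂ)) := by
    rw [inner_zero_right]
    congr 1
    push_cast
    ring
  rw [hval]
  simp_rw [hX.brownian.charFun_eulerSum A B s u _ ξ]
  exact hlim

/-- The Euler approximation of `X_t`, for `t ≤ s`, as a function of the initial state and of the
noise up to time `s`. -/
def eulerState (A B : Matrix (Fin n) (Fin n) ℝ) (s t : ℝ≥0) (m : ℕ)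
    (q : Vec n × (Set.Iic s → Vec n)) : Vec n :=
  Matrix.toEuclideanCLM (𝕜 := ℝ) (expA A t) q.1
    + eulerSum (Matrix.toEuclideanCLM (𝕜 := ℝ) A) (Matrix.toEuclideanCLM (𝕜 := ℝ) B) t
      (fun r => q.2 ⟨min r.toNNReal s, Set.mem_Iic.2 (min_le_right _ _)⟩) m

lemma measurable_eulerState (A B : Matrix (Fin n) (Fin n) ℝ) (s t : ℝ≥0) (m : ℕ) :
    Measurable (eulerState A B s t m) := by
  have h : ∀ r : ℝ, Measurable fun q : Vec n × (Set.Iic s → Vec n) =>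
      q.2 ⟨min r.toNNReal s, Set.mem_Iic.2 (min_le_right _ _)⟩ := fun r =>
    (measurable_pi_apply (⟨min r.toNNReal s, Set.mem_Iic.2 (min_le_right _ _)⟩ : Set.Iic s)).comp
      measurable_snd
  exact ((ContinuousLinearMap.measurable _).comp measurable_fst).add
    (measurable_eulerSum _ _ t h m)

/-- Adaptedness is no part of `IsSolution`; it is recovered from the equation, up to a null set, in
this form. -/
lemma IsSolution.tendsto_eulerState (hX : IsSolution P A B S₀ W X) {s t : ℝ≥0} (hts : t ≤ s) :
    ∀ᵐ ω ∂P, Tendsto (fun m => eulerState A B s t m (X 0 ω, fun r => W r ω)) atTop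
      (nhds (X t ω)) := by
  filter_upwards [hX.tendsto_eulerSum 0 t] with ω hω
  have h := hω.const_add (Matrix.toEuclideanCLM (𝕜 := ℝ) (expA A t) (X 0 ω))
  rw [accumulatedNoise, zero_add, add_sub_cancel] at h
  refine h.congr fun m => ?_
  unfold eulerState eulerSum
  congr 1
  refine Finset.sum_congr rfl fun j hj => ?_
  have hj' := Finset.mem_range.1 hj
  -- All mesh points lie below `t ≤ s`, so the truncation at `s`, there only to index the past of
  -- `W`, has no effect.
  have hmin : ∀ l ≤ m, min ((l : ℝ) * ((t : ℝ) / m)).toNNReal s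
      = 0 + ((l : ℝ) * ((t : ℝ) / m)).toNNReal := fun l hl => by
    rw [zero_add]
    refine min_eq_left (le_trans ?_ hts)
    exact Real.toNNReal_le_iff_le_coe.2 (mesh_mem t.coe_nonneg hl).2
  rw [sub_sub_sub_cancel_right]
  simp only [hmin _ hj', hmin _ hj'.le]

/-- The accumulated noise is independent of the past samples. -/
lemma IsSolution.indepFun_accumulatedNoise [IsProbabilityMeasure P]
    (hX : IsSolution P A B S₀ W X) (s u : ℝ≥0) {K : ℕ} (t : Fin K → ℝ≥0) (ht : ∀ i, t i ≤ s) :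
    IndepFun (accumulatedNoise A X s u) (fun ω i => X (t i) ω) P := by
  have hm := hX.brownian.measurable
  have hXm := hX.measurable
  have hφ : ∀ m, Measurable fun w : ℝ≥0 → Vec n => eulerSum (Matrix.toEuclideanCLM (𝕜 := ℝ) A)
      (Matrix.toEuclideanCLM (𝕜 := ℝ) B) u (fun r => w r.toNNReal) m := fun m =>
    measurable_eulerSum _ _ u (fun r => measurable_pi_apply r.toNNReal) m
  have hψ : ∀ m, Measurable fun q (i : Fin K) => eulerState A B s (t i) m q := fun m =>
    measurable_pi_iff.2 fun i => measurable_eulerState A B s (t i) m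
  have hV : Measurable fun ω (r : ℝ≥0) => W (s + r) ω - W s ω := by fun_prop
  have hp : Measurable fun ω => (X 0 ω, fun r : Set.Iic s => W r ω) := by fun_prop
  -- The approximations of the noise use increments after `s`, those of the states use `X 0` and `W`
  -- up to `s`; each pair is independent before the limit is taken.
  have hind : ∀ m, IndepFun
      (fun ω => eulerSum (Matrix.toEuclideanCLM (𝕜 := ℝ) A)
        (Matrix.toEuclideanCLM (𝕜 := ℝ) B) u (fun r => W (s + r.toNNReal) ω - W s ω) m)
      (fun ω (i : Fin K) => eulerState A B s (t i) m (X 0 ω, fun r => W r ω)) P := fun m =>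
    ((hX.indepFun_past_future s).comp (hψ m) (hφ m)).symm
  have hgt : ∀ᵐ ω ∂P, Tendsto
      (fun m (i : Fin K) => eulerState A B s (t i) m (X 0 ω, fun r => W r ω)) atTop
      (nhds fun i => X (t i) ω) := by
    filter_upwards [ae_all_iff.2 fun i => hX.tendsto_eulerState (ht i)] with ω hω
    exact tendsto_pi_nhds.2 hω
  exact indepFun_of_tendsto_ae (fun m => (hφ m).comp hV) (fun m => (hψ m).comp hp)
    (hX.measurable_accumulatedNoise s u) (measurable_pi_iff.2 fun i => hXm (t i)) hind
    (hX.tendsto_eulerSum s u) hgt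

end Solution

/-! ### The samples and the discrete-time source have the same law -/

lemma accumulatedNoise_sample {Ω : Type*} {n : ℕ} (A : Matrix (Fin n) (Fin n) ℝ)
    (X : ℝ≥0 → Ω → Vec n) (τ : ℝ≥0) (k : ℕ) (ω : Ω) :
    samples X τ (k + 1) ω - Matrix.toEuclideanCLM (𝕜 := ℝ) (expA A τ) (samples X τ k ω)
      = accumulatedNoise A X (k * τ) τ ω := by
  rw [accumulatedNoise, samples, samples]
  push_cast
  rw [add_one_mul]

section SampleLaw

variable {Ω Ω' : Type*} [MeasurableSpace Ω] [MeasurableSpace Ω'] {P : Measure Ω} {P' : Measure Ω'}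
  {n : ℕ}

/-- The law of a linear recursion with independent innovations is determined by the initial law
and the laws of the innovations. -/
lemma map_finProcess_congr [IsProbabilityMeasure P] [IsProbabilityMeasure P']
    {x : ℕ → Ω → Vec n} {x' : ℕ → Ω' → Vec n}
    (hx : ∀ k, Measurable (x k)) (hx' : ∀ k, Measurable (x' k)) (c : Vec n →L[ℝ] Vec n)
    (h0 : P.map (x 0) = P'.map (x' 0))
    (hN : ∀ k, (P.map fun ω => x (k + 1) ω - c (x k ω))
      = P'.map fun ω => x' (k + 1) ω - c (x' k ω))
    (hi : ∀ k, IndepFun (fun ω => x (k + 1) ω - c (x k ω)) (fun ω (i : Fin (k + 1)) => x i ω) P)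
    (hi' : ∀ k, IndepFun (fun ω => x' (k + 1) ω - c (x' k ω))
      (fun ω (i : Fin (k + 1)) => x' i ω) P') (K : ℕ) :
    (P.map fun ω (i : Fin K) => x i ω) = P'.map fun ω (i : Fin K) => x' i ω := by
  have hsucc : ∀ K, (P.map fun ω (i : Fin (K + 1)) => x i ω)
      = P'.map fun ω (i : Fin (K + 1)) => x' i ω := by
    intro K
    induction K with
    | zero =>
      have h := congrArg (Measure.map fun (v : Vec n) (_ : Fin 1) => v) h0
      rw [Measure.map_map (by fun_prop) (hx 0), Measure.map_map (by fun_prop) (hx' 0)] at h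
      convert h using 2
      · funext ω i
        rw [Fin.eq_zero i]
        rfl
      · funext ω i
        rw [Fin.eq_zero i]
        rfl
    | succ K ih =>
      have e := (indepFun_iff_map_prod_eq_prod_map_map (by fun_prop) (by fun_prop)).1 (hi K)
      have e' := (indepFun_iff_map_prod_eq_prod_map_map (by fun_prop) (by fun_prop)).1 (hi' K)
      rw [hN, ih, ← e'] at e
      have hΦ : Measurable fun q : Vec n × (Fin (K + 1) → Vec n) =>
          (Fin.snoc q.2 (c (q.2 (Fin.last K)) + q.1) : Fin (K + 2) → Vec n) :=
        measurable_finSnoc.comp (measurable_snd.prodMk (by fun_prop))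
      have h := congrArg (Measure.map fun q : Vec n × (Fin (K + 1) → Vec n) =>
          (Fin.snoc q.2 (c (q.2 (Fin.last K)) + q.1) : Fin (K + 2) → Vec n)) e
      rw [Measure.map_map hΦ (by fun_prop), Measure.map_map hΦ (by fun_prop)] at h
      convert h using 2
      · funext ω i
        refine Fin.lastCases ?_ (fun j => ?_) i <;> simp
      · funext ω i
        refine Fin.lastCases ?_ (fun j => ?_) i <;> simp
  have h := congrArg (Measure.map (Fin.init : (Fin (K + 1) → Vec n) → _)) (hsucc K)
  rw [Measure.map_map measurable_finInit (by fun_prop),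
    Measure.map_map measurable_finInit (by fun_prop)] at h
  exact h

variable (A B S₀ : Matrix (Fin n) (Fin n) ℝ)

lemma dtState_succ_sub (τ : ℝ) (k : ℕ) (p : Vec n × (ℕ → Vec n)) :
    dtState A B τ (k + 1) p - Matrix.toEuclideanCLM (𝕜 := ℝ) (expA A τ) (dtState A B τ k p)
      = Matrix.toEuclideanCLM (𝕜 := ℝ) (noiseRoot A B τ) (p.2 k) := by
  rw [dtState, add_sub_cancel_left]

lemma dtSource_map_fst : (dtSource S₀).map Prod.fst = multivariateGaussian 0 S₀ :=
  Measure.fst_prod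

lemma dtSource_map_noise (τ : ℝ) (k : ℕ) :
    (dtSource S₀).map (fun p => Matrix.toEuclideanCLM (𝕜 := ℝ) (noiseRoot A B τ) (p.2 k))
      = multivariateGaussian 0 (noiseCov A B τ) := by
  have h1 : (dtSource S₀).map (fun p => p.2 k) = stdGaussian (Vec n) := by
    have : (dtSource S₀).map Prod.snd = Measure.infinitePi fun _ : ℕ => stdGaussian (Vec n) :=
      Measure.snd_prod
    have h2 := Measure.infinitePi_map_eval (fun _ : ℕ => stdGaussian (Vec n)) k
    rw [← this, Measure.map_map (by fun_prop) (by fun_prop)] at h2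
    exact h2
  -- `multivariateGaussian` is by definition an image of the standard Gaussian under the square root
  -- of the covariance, here `noiseRoot`.
  rw [multivariateGaussian, ← h1, Measure.map_map (by fun_prop) (by fun_prop)]
  simp only [zero_add, noiseRoot]
  rfl

/-- The states up to time `k` use the noises before `k` only. Later noises may be set to `0`, which
makes the dependence on finitely many coordinates explicit. -/
lemma dtState_eq_comp (τ : ℝ) (k : ℕ) :
    ∃ f : Vec n × (Finset.range k → Vec n) → (Fin (k + 1) → Vec n), Measurable f ∧
      ∀ p, (fun i : Fin (k + 1) => dtState A B τ i p)
        = f (p.1, fun i => p.2 i) := by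
  let r : Vec n × (Finset.range k → Vec n) → Vec n × (ℕ → Vec n) := fun q =>
    (q.1, fun i => if h : i ∈ Finset.range k then q.2 ⟨i, h⟩ else 0)
  have hr : Measurable r := by
    refine measurable_fst.prodMk (measurable_pi_iff.2 fun i => ?_)
    by_cases h : i ∈ Finset.range k
    · simp only [h, dite_true]
      fun_prop
    · simp only [h, dite_false]
      fun_prop
  refine ⟨fun q i => dtState A B τ i (r q),
    measurable_pi_iff.2 fun i => (measurable_dtState A B τ i).comp hr, fun p => ?_⟩
  have : ∀ i ≤ k, dtState A B τ i p = dtState A B τ i (r (p.1, fun i => p.2 i)) := by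
    intro i
    induction i with
    | zero => exact fun _ => rfl
    | succ i ih =>
      intro hi
      have hm : i ∈ Finset.range k := Finset.mem_range.2 hi
      simp only [dtState, ih (Nat.le_of_succ_le hi), r, hm, dite_true]
  exact funext fun i => this i (Nat.le_of_lt_succ i.isLt)

lemma indepFun_dtNoise (τ : ℝ) (k : ℕ) :
    IndepFun (fun p => Matrix.toEuclideanCLM (𝕜 := ℝ) (noiseRoot A B τ) (p.2 k))
      (fun p (i : Fin (k + 1)) => dtState A B τ i p) (dtSource S₀) := by
  obtain ⟨f, hf, hfe⟩ := dtState_eq_comp A B τ k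
  have hiid : iIndepFun (fun i (w : ℕ → Vec n) => w i)
      (Measure.infinitePi fun _ : ℕ => stdGaussian (Vec n)) :=
    iIndepFun_infinitePi (X := fun _ v => v) fun _ => measurable_id
  have hfin := hiid.indepFun_finset (Finset.range k) {k} (by simp) fun i => measurable_pi_apply i
  have hsnd : (dtSource S₀).map Prod.snd = Measure.infinitePi fun _ : ℕ => stdGaussian (Vec n) :=
    Measure.snd_prod
  rw [← hsnd] at hfin
  have h2 : IndepFun (fun p : Vec n × (ℕ → Vec n) => fun i : Finset.range k => p.2 i)
      (fun p => p.2 k) (dtSource S₀) := by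
    have hk : Measurable fun w : ({k} : Finset ℕ) → Vec n => w ⟨k, Finset.mem_singleton_self k⟩ :=
      measurable_pi_apply _
    have h3 : IndepFun (fun (w : ℕ → Vec n) (i : Finset.range k) => w i) (fun w => w k)
        ((dtSource S₀).map Prod.snd) := hfin.comp measurable_id hk
    have hm1 : Measurable fun (w : ℕ → Vec n) (i : Finset.range k) => w i := by fun_prop
    have hm2 : Measurable fun w : ℕ → Vec n => w k := by fun_prop
    rw [indepFun_iff_map_prod_eq_prod_map_map hm1.aemeasurable hm2.aemeasurable] at h3
    rw [indepFun_iff_map_prod_eq_prod_map_map (by fun_prop) (by fun_prop)]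
    rw [Measure.map_map (by fun_prop) (by fun_prop), Measure.map_map (by fun_prop) (by fun_prop),
      Measure.map_map (by fun_prop) (by fun_prop)] at h3
    exact h3
  have h1 : IndepFun (Prod.fst : Vec n × (ℕ → Vec n) → Vec n)
      (fun p => ((fun i : Finset.range k => p.2 i), p.2 k)) (dtSource S₀) :=
    indepFun_prod (X := id) (Y := fun w : ℕ → Vec n => ((fun i : Finset.range k => w i), w k))
      measurable_id (by fun_prop)
  have h4 := indepFun_prodMk_left measurable_fst (by fun_prop) (by fun_prop) h1 h2
  have h5 := (h4.comp (φ := f)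
    (ψ := fun v => Matrix.toEuclideanCLM (𝕜 := ℝ) (noiseRoot A B τ) v) hf (by fun_prop)).symm
  rw [show (fun p (i : Fin (k + 1)) => dtState A B τ i p) = _ from funext hfe]
  exact h5

variable {A B S₀}

lemma IsSolution.indepFun_samples [IsProbabilityMeasure P] {W X : ℝ≥0 → Ω → Vec n}
    (hX : IsSolution P A B S₀ W X) (τ u : ℝ≥0) (k : ℕ) :
    IndepFun (accumulatedNoise A X (k * τ) u) (fun ω (i : Fin (k + 1)) => samples X τ i ω) P := by
  refine hX.indepFun_accumulatedNoise (k * τ) u (fun i : Fin (k + 1) => (i : ℕ) * τ) fun i => ?_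
  gcongr
  exact Nat.le_of_lt_succ i.isLt

lemma IsSolution.measurable_samples {W X : ℝ≥0 → Ω → Vec n} (hX : IsSolution P A B S₀ W X)
    (τ : ℝ≥0) (k : ℕ) : Measurable (samples X τ k) := hX.measurable _

/-- Both sequences are recursions with the linear map `e^{Aτ}`, the same initial law, and
innovations that are independent of the past with law `𝒩(0, noiseCov A B τ)`. -/
lemma IsSolution.map_samples [IsProbabilityMeasure P] {W X : ℝ≥0 → Ω → Vec n}
    (hX : IsSolution P A B S₀ W X) (τ : ℝ≥0) (K : ℕ) :
    (P.map fun ω (i : Fin K) => samples X τ i ω)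
      = (dtSource S₀).map fun p (i : Fin K) => dtState A B τ i p := by
  refine map_finProcess_congr (hX.measurable_samples τ) (measurable_dtState A B τ)
    (Matrix.toEuclideanCLM (𝕜 := ℝ) (expA A τ)) ?_ (fun k => ?_) (fun k => ?_) (fun k => ?_) K
  · have : samples X τ 0 = X 0 := by simp [samples]
    rw [this, hX.initial]
    exact (dtSource_map_fst S₀).symm
  · simp only [accumulatedNoise_sample, dtState_succ_sub]
    rw [dtSource_map_noise]
    exact hX.map_accumulatedNoise _ _
  · simp only [accumulatedNoise_sample]
    exact hX.indepFun_samples τ τ k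
  · simp only [dtState_succ_sub]
    exact indepFun_dtNoise A B S₀ τ k


end SampleLaw

/-! ### The continuous-time error -/

section Moments

variable {Ω : Type*} [MeasurableSpace Ω] {P : Measure Ω} {n : ℕ}

lemma lintegral_enorm_sq_eq {f : Ω → Vec n} (hf : MemLp f 2 P) :
    ∫⁻ ω, ‖f ω‖ₑ ^ 2 ∂P = ENNReal.ofReal (∫ ω, ‖f ω‖ ^ 2 ∂P) := by
  rw [ofReal_integral_eq_lintegral_ofReal (hf.integrable_norm_pow two_ne_zero)
    (ae_of_all _ fun ω => by positivity)]
  refine lintegral_congr fun ω => ?_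
  rw [ENNReal.ofReal_pow (norm_nonneg _), ofReal_norm]

/-- The second moments of independent vectors add up, if one of them is centred. -/
lemma lintegral_enorm_add_sq_of_indepFun {U V : Ω → Vec n} [IsProbabilityMeasure P]
    (hU : MemLp U 2 P) (hV : MemLp V 2 P) (hind : IndepFun U V P) (h0 : ∫ ω, V ω ∂P = 0) :
    ∫⁻ ω, ‖U ω + V ω‖ₑ ^ 2 ∂P = ∫⁻ ω, ‖U ω‖ₑ ^ 2 ∂P + ∫⁻ ω, ‖V ω‖ₑ ^ 2 ∂P := by
  have hUi := hU.integrable one_le_two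
  have hVi := hV.integrable one_le_two
  have hcross : ∫ ω, inner ℝ (U ω) (V ω) ∂P = 0 := by
    have h := hind.integral_bilin hUi hVi (innerSL ℝ)
    rw [h0, map_zero] at h
    exact h
  have hci : Integrable (fun ω => (inner ℝ (U ω) (V ω) : ℝ)) P :=
    hind.integrable_bilin hUi hVi (innerSL ℝ)
  have hU2 := hU.integrable_norm_pow two_ne_zero
  have hV2 := hV.integrable_norm_pow two_ne_zero
  have hsum := lintegral_enorm_sq_eq (hU.add hV)
  simp only [Pi.add_apply] at hsum
  rw [lintegral_enorm_sq_eq hU, lintegral_enorm_sq_eq hV, hsum,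
    ← ENNReal.ofReal_add (integral_nonneg fun _ => by positivity)
      (integral_nonneg fun _ => by positivity)]
  simp_rw [norm_add_sq_real]
  rw [integral_add (f := fun ω => ‖U ω‖ ^ 2 + 2 * inner ℝ (U ω) (V ω))
    (hU2.add (hci.const_mul 2)) hV2, integral_add hU2 (hci.const_mul 2),
    integral_const_mul, hcross, mul_zero, add_zero]

lemma lintegral_enorm_sq_multivariateGaussian {S : Matrix (Fin n) (Fin n) ℝ}
    (hS : S.PosSemidef) :
    ∫⁻ v, ‖v‖ₑ ^ 2 ∂multivariateGaussian 0 S = ENNReal.ofReal S.trace := by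
  have hm : MemLp id 2 (multivariateGaussian 0 S) := IsGaussian.memLp_two_id
  have hmi : ∀ i, MemLp (fun v : Vec n => v i) 2 (multivariateGaussian 0 S) := fun i =>
    (EuclideanSpace.proj (𝕜 := ℝ) i).comp_memLp' hm
  have h := lintegral_enorm_sq_eq hm
  simp only [id_eq] at h
  rw [h]
  simp_rw [EuclideanSpace.real_norm_sq_eq]
  rw [integral_finsetSum _ fun i _ => (hmi i).integrable_sq, Matrix.trace]
  congr 1
  refine Finset.sum_congr rfl fun i _ => ?_
  rw [Matrix.diag, ← variance_eval_multivariateGaussian hS (μ := 0) i,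
    variance_of_integral_eq_zero (hmi i).1.aemeasurable]
  have h0 := (EuclideanSpace.proj (𝕜 := ℝ) i).integral_comp_comm (hm.integrable one_le_two)
  simp only [id_eq, integral_id_multivariateGaussian, map_zero] at h0
  exact h0

end Moments

section Error

variable {Ω : Type*} [MeasurableSpace Ω] {P : Measure Ω} [IsProbabilityMeasure P] {n : ℕ}
  {A B S₀ : Matrix (Fin n) (Fin n) ℝ} {W X : ℝ≥0 → Ω → Vec n}

lemma IsSolution.memLp_accumulatedNoise (hX : IsSolution P A B S₀ W X) (s u : ℝ≥0) :
    MemLp (accumulatedNoise A X s u) 2 P := by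
  have hm : MemLp id 2 (P.map (accumulatedNoise A X s u)) := by
    rw [hX.map_accumulatedNoise]
    exact IsGaussian.memLp_two_id
  exact (memLp_map_measure_iff (by fun_prop)
    (hX.measurable_accumulatedNoise s u).aemeasurable).1 hm

lemma IsSolution.integral_accumulatedNoise (hX : IsSolution P A B S₀ W X) (s u : ℝ≥0) :
    ∫ ω, accumulatedNoise A X s u ω ∂P = 0 := by
  have h := integral_map (μ := P) (f := id) (hX.measurable_accumulatedNoise s u).aemeasurable (by fun_prop)
  simp only [id_eq, hX.map_accumulatedNoise, integral_id_multivariateGaussian] at h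
  exact h.symm

lemma IsSolution.lintegral_accumulatedNoise (hX : IsSolution P A B S₀ W X) (s u : ℝ≥0) :
    ∫⁻ ω, ‖accumulatedNoise A X s u ω‖ₑ ^ 2 ∂P = ENNReal.ofReal (noiseCov A B u).trace := by
  rw [← lintegral_enorm_sq_multivariateGaussian (posSemidef_noiseCov A B u.coe_nonneg),
    ← hX.map_accumulatedNoise s u,
    lintegral_map (by fun_prop) (hX.measurable_accumulatedNoise s u)]

lemma IsSolution.memLp (hX : IsSolution P A B S₀ W X) (t : ℝ≥0) : MemLp (X t) 2 P := by
  have h0 : MemLp (X 0) 2 P := by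
    have hm : MemLp id 2 (P.map (X 0)) := by
      rw [hX.initial]
      exact IsGaussian.memLp_two_id
    exact (memLp_map_measure_iff (by fun_prop) (hX.measurable 0).aemeasurable).1 hm
  have h := (hX.memLp_accumulatedNoise 0 t).add
    ((Matrix.toEuclideanCLM (𝕜 := ℝ) (expA A t)).comp_memLp' h0)
  refine h.congr_norm (hX.measurable t).aestronglyMeasurable (ae_of_all _ fun ω => ?_)
  simp [accumulatedNoise]

lemma memLp_comp_fst {x : ℕ → Ω → Vec n} (hx : ∀ k, Measurable (x k))
    (π : CausalPolicy (Vec n) Packet) (K : ℕ) {f : Ω → Vec n} (hf : MemLp f 2 P) :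
    MemLp (fun p : Ω × (Fin K → Packet) => f p.1) 2 (jointLaw P x π K) := by
  have h : MemLp f 2 ((jointLaw P x π K).map Prod.fst) := by rwa [jointLaw_map_fst P hx]
  exact h.comp_of_map measurable_fst.aemeasurable

/-- Between two sampling times, the estimate evolves by the drift alone. -/
lemma IsSolution.estimate_eq (hX : IsSolution P A B S₀ W X) (τ s : ℝ≥0)
    (π : CausalPolicy (Vec n) Packet) (k : ℕ) :
    estimate P (samples X τ) π k (X (k * τ + s))
      =ᵐ[jointLaw P (samples X τ) π (k + 1)] fun p =>
        Matrix.toEuclideanCLM (𝕜 := ℝ) (expA A s)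
          (estimate P (samples X τ) π k (samples X τ k) p) := by
  have hx := hX.measurable_samples τ
  have := isProbabilityMeasure_jointLaw P hx π (k + 1)
  have hNm := hX.measurable_accumulatedNoise (k * τ) s
  have hN := memLp_comp_fst hx π (k + 1) (hX.memLp_accumulatedNoise (k * τ) s)
  have hU := memLp_comp_fst hx π (k + 1) (hX.memLp (k * τ))
  have hind := indepFun_jointLaw P hx π (k + 1) hNm (hX.indepFun_samples τ s k)
  -- The packets up to `k` are independent of the noise after `kτ`, whose conditional expectation is
  -- thus its mean, zero.
  have hind2 := hind.comp (φ := id) (ψ := Prod.snd) measurable_id measurable_snd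
  set J := jointLaw P (samples X τ) π (k + 1)
  set c := Matrix.toEuclideanCLM (𝕜 := ℝ) (expA A s)
  have hsplit : (fun p : Ω × (Fin (k + 1) → Packet) => X (k * τ + s) p.1)
      = (c ∘ fun p => X (k * τ) p.1) + fun p => accumulatedNoise A X (k * τ) s p.1 := by
    funext p
    simp [accumulatedNoise, c]
  have hle : MeasurableSpace.comap (Prod.snd : Ω × (Fin (k + 1) → Packet) → _) inferInstance
      ≤ (inferInstance : MeasurableSpace (Ω × (Fin (k + 1) → Packet))) := measurable_snd.comap_le
  have h1 := condExp_add (m := MeasurableSpace.comap Prod.snd inferInstance)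
    ((c.comp_memLp' hU).integrable one_le_two) (hN.integrable one_le_two)
  have h2 := c.comp_condExp_comm (m := MeasurableSpace.comap Prod.snd inferInstance)
    (hU.integrable one_le_two)
  have h3 := condExp_indep_eq (μ := J) (hNm.comp measurable_fst).comap_le hle
    (f := fun p => accumulatedNoise A X (k * τ) s p.1)
    (comap_measurable _).stronglyMeasurable hind2
  have h4 : ∫ p, accumulatedNoise A X (k * τ) s p.1 ∂J = 0 := by
    have h := integral_map (μ := J) (f := accumulatedNoise A X (k * τ) s)
      measurable_fst.aemeasurable (hNm.aestronglyMeasurable)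
    rw [← h, jointLaw_map_fst P hx, hX.integral_accumulatedNoise]
  simp only [estimate]
  rw [hsplit]
  filter_upwards [h1, h2, h3] with p e1 e2 e3
  rw [e1, Pi.add_apply, ← e2, e3, h4, add_zero]
  rfl

/-- The propagated estimation error is a function of samples and packets up to `k`, hence
independent of the centred noise since `kτ`, and the cross term vanishes. The strict bound `s < τ`
keeps the current packet index equal to `k`. -/
lemma IsSolution.ctError_eq (hX : IsSolution P A B S₀ W X) {τ s : ℝ≥0} (hs : s < τ)
    (π : CausalPolicy (Vec n) Packet) (k : ℕ) :
    ctError P X τ π (k * τ + s)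
      = ∫⁻ p, ‖Matrix.toEuclideanCLM (𝕜 := ℝ) (expA A s)
            (samples X τ k p.1 - estimate P (samples X τ) π k (samples X τ k) p)‖ₑ ^ 2
          ∂jointLaw P (samples X τ) π (k + 1)
        + ENNReal.ofReal (noiseCov A B s).trace := by
  have hfloor : ⌊(k * τ + s) / τ⌋₊ = k := by
    have hτ : 0 < τ := (zero_le).trans_lt hs
    rw [Nat.floor_eq_iff (zero_le), le_div_iff₀ hτ, div_lt_iff₀ hτ, add_one_mul]
    exact ⟨le_self_add, by gcongr⟩
  have hx := hX.measurable_samples τ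
  have := isProbabilityMeasure_jointLaw P hx π (k + 1)
  have hNm := hX.measurable_accumulatedNoise (k * τ) s
  have hN := memLp_comp_fst hx π (k + 1) (hX.memLp_accumulatedNoise (k * τ) s)
  have hU := memLp_comp_fst hx π (k + 1) (hX.memLp (k * τ))
  have hE := hU.condExp (m := MeasurableSpace.comap Prod.snd inferInstance) one_le_two
  have hind := indepFun_jointLaw P hx π (k + 1) hNm (hX.indepFun_samples τ s k)
  obtain ⟨g, hg, hge⟩ := exists_estimate_eq P (samples X τ) π k (samples X τ k)
  have hest := hX.estimate_eq τ s π k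
  have hV : MemLp (fun p => Matrix.toEuclideanCLM (𝕜 := ℝ) (expA A s)
      (samples X τ k p.1 - estimate P (samples X τ) π k (samples X τ k) p)) 2
      (jointLaw P (samples X τ) π (k + 1)) :=
    (Matrix.toEuclideanCLM (𝕜 := ℝ) (expA A s)).comp_memLp' (hU.sub hE)
  have hindV : IndepFun (fun p => Matrix.toEuclideanCLM (𝕜 := ℝ) (expA A s)
      (samples X τ k p.1 - estimate P (samples X τ) π k (samples X τ k) p))
      (fun p => accumulatedNoise A X (k * τ) s p.1) (jointLaw P (samples X τ) π (k + 1)) := by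
    rw [hge]
    exact (hind.comp (φ := id)
      (ψ := fun q : (Fin (k + 1) → Vec n) × (Fin (k + 1) → Packet) =>
        Matrix.toEuclideanCLM (𝕜 := ℝ) (expA A s) (q.1 (Fin.last k) - g q.2))
      measurable_id (by fun_prop)).symm
  have h4 : ∫ p, accumulatedNoise A X (k * τ) s p.1 ∂jointLaw P (samples X τ) π (k + 1) = 0 := by
    have h := integral_map (μ := jointLaw P (samples X τ) π (k + 1))
      (f := accumulatedNoise A X (k * τ) s)
      measurable_fst.aemeasurable (hNm.aestronglyMeasurable)
    rw [← h, jointLaw_map_fst P hx, hX.integral_accumulatedNoise]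
  have h5 : ∫⁻ p, ‖accumulatedNoise A X (k * τ) s p.1‖ₑ ^ 2
      ∂jointLaw P (samples X τ) π (k + 1) = ENNReal.ofReal (noiseCov A B s).trace := by
    have h := lintegral_map (μ := jointLaw P (samples X τ) π (k + 1))
      (f := fun ω => ‖accumulatedNoise A X (k * τ) s ω‖ₑ ^ 2) (by fun_prop) measurable_fst
    rw [← h, jointLaw_map_fst P hx, hX.lintegral_accumulatedNoise]
  rw [ctError, hfloor, ← h5, ← lintegral_enorm_add_sq_of_indepFun hV hN hindV h4]
  refine lintegral_congr_ae ?_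
  filter_upwards [hest] with p hp
  rw [hp]
  congr 2
  simp only [accumulatedNoise, map_sub, samples]
  abel

end Error

/-! ### The continuous-time distortion -/

section Distortion

variable {Ω : Type*} [MeasurableSpace Ω] {P : Measure Ω} [IsProbabilityMeasure P] {n : ℕ}
  {A B S₀ : Matrix (Fin n) (Fin n) ℝ} {W X : ℝ≥0 → Ω → Vec n}

lemma ofReal_bBar (A B : Matrix (Fin n) (Fin n) ℝ) {τ : ℝ} (hτ : 0 ≤ τ) :
    ENNReal.ofReal (bBar A B τ)
      = ∫⁻ t in Set.Ioc 0 τ, ENNReal.ofReal (noiseCov A B t).trace := by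
  rw [bBar_eq A B hτ, intervalIntegral.integral_of_le hτ,
    ofReal_integral_eq_lintegral_ofReal (continuous_trace_noiseCov A B).integrableOn_Ioc]
  exact ae_restrict_of_forall_mem measurableSet_Ioc fun t ht =>
    trace_noiseCov_nonneg A B ht.1.le

lemma bBar_nonneg (A B : Matrix (Fin n) (Fin n) ℝ) {τ : ℝ} (hτ : 0 ≤ τ) : 0 ≤ bBar A B τ := by
  rw [bBar_eq A B hτ]
  exact intervalIntegral.integral_nonneg hτ fun t ht => trace_noiseCov_nonneg A B ht.1

/-- The accumulated error over one sampling period. -/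
lemma IsSolution.lintegral_ctError_period (hX : IsSolution P A B S₀ W X) (τ : ℝ≥0)
    (π : CausalPolicy (Vec n) Packet) (k : ℕ) :
    ∫⁻ t in Set.Ioc (k * τ : ℝ) (k * τ + τ), ctError P X τ π t.toNNReal
      = ∫⁻ p, weightedSq (Qbar A τ)
            (samples X τ k p.1 - estimate P (samples X τ) π k (samples X τ k) p)
          ∂jointLaw P (samples X τ) π (k + 1)
        + ENNReal.ofReal (bBar A B τ) := by
  have hx := hX.measurable_samples τ
  have := isProbabilityMeasure_jointLaw P hx π (k + 1)
  obtain ⟨g, hg, hge⟩ := exists_estimate_eq P (samples X τ) π k (samples X τ k)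
  have hmp := (measurePreserving_add_left (volume : Measure ℝ) (k * τ)).setLIntegral_comp_preimage_emb
    (measurableEmbedding_addLeft _) (fun t => ctError P X τ π t.toNNReal)
    (Set.Ioo (k * τ : ℝ) (k * τ + τ))
  have hpre : ((k * τ : ℝ) + ·) ⁻¹' Set.Ioo (k * τ : ℝ) (k * τ + τ) = Set.Ioo 0 (τ : ℝ) := by
    ext t
    simp
  -- At the right end point packet `k + 1` is already available, so the error formula is applied on
  -- the open interval; the difference is a null set.
  rw [setLIntegral_congr Ioo_ae_eq_Ioc.symm, ← hmp, hpre,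
    setLIntegral_congr_fun measurableSet_Ioo (g := fun t =>
      ∫⁻ p, ‖Matrix.toEuclideanCLM (𝕜 := ℝ) (expA A t)
            (samples X τ k p.1 - estimate P (samples X τ) π k (samples X τ k) p)‖ₑ ^ 2
          ∂jointLaw P (samples X τ) π (k + 1)
        + ENNReal.ofReal (noiseCov A B t).trace) fun t ht => ?_,
    setLIntegral_congr Ioo_ae_eq_Ioc,
    lintegral_add_right _ (continuous_trace_noiseCov A B).measurable.ennreal_ofReal,
    ← ofReal_bBar A B τ.coe_nonneg, lintegral_lintegral_swap]
  · simp_rw [weightedSq_Qbar A τ.coe_nonneg]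
  · rw [hge]
    have hc : Measurable fun q : ℝ × Vec n =>
        Matrix.toEuclideanCLM (𝕜 := ℝ) (expA A q.1) q.2 := by
      simp_rw [toEuclideanCLM_expA]
      have h := continuous_exp_smul (Matrix.toEuclideanCLM (𝕜 := ℝ) A)
      exact ((h.comp continuous_fst).clm_apply continuous_snd).measurable
    have hd : Measurable fun q : ℝ × (Ω × (Fin (k + 1) → Packet)) =>
        (q.1, samples X τ k q.2.1 - g q.2.2) := by fun_prop
    exact ((hc.comp hd).enorm.pow_const 2).aemeasurable
  · have hst : t.toNNReal < τ := by
      rw [Real.toNNReal_lt_iff_lt_coe ht.1.le]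
      exact ht.2
    have h := hX.ctError_eq hst π k
    rw [Real.coe_toNNReal _ ht.1.le] at h
    refine Eq.trans ?_ h
    congr 1
    rw [Real.toNNReal_add (by positivity) ht.1.le]
    congr 1
    exact Real.toNNReal_coe (r := k * τ)

lemma IsSolution.lintegral_ctError (hX : IsSolution P A B S₀ W X) (τ : ℝ≥0)
    (π : CausalPolicy (Vec n) Packet) (K : ℕ) :
    ∫⁻ t in Set.Ioc 0 (K * τ : ℝ), ctError P X τ π t.toNNReal
      = ∑ k ∈ Finset.range K, ∫⁻ p, weightedSq (Qbar A τ)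
            (samples X τ k p.1 - estimate P (samples X τ) π k (samples X τ k) p)
          ∂jointLaw P (samples X τ) π (k + 1)
        + K * ENNReal.ofReal (bBar A B τ) := by
  induction K with
  | zero => simp
  | succ K ih =>
    have hun : Set.Ioc 0 (((K + 1 : ℕ) : ℝ) * τ)
        = Set.Ioc 0 (K * τ : ℝ) ∪ Set.Ioc (K * τ : ℝ) (K * τ + τ) := by
      rw [Set.Ioc_union_Ioc_eq_Ioc (by positivity) (by simp)]
      push_cast
      rw [add_one_mul]
    rw [hun, lintegral_union measurableSet_Ioc
      (Set.Ioc_disjoint_Ioc_of_le le_rfl), ih,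
      hX.lintegral_ctError_period, Finset.sum_range_succ]
    push_cast
    ring

/-- The weighted error of the discrete-time source. -/
lemma IsSolution.lintegral_error_samples (hX : IsSolution P A B S₀ W X) (τ : ℝ≥0)
    (π : CausalPolicy (Vec n) Packet) (k : ℕ) {w : Vec n → ℝ≥0∞} (hw : Measurable w) :
    ∫⁻ p, w (samples X τ k p.1 - estimate P (samples X τ) π k (samples X τ k) p)
        ∂jointLaw P (samples X τ) π (k + 1)
      = ∫⁻ p, w (dtState A B τ k p.1
            - estimate (dtSource S₀) (dtState A B τ) π k (dtState A B τ k) p)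
          ∂jointLaw (dtSource S₀) (dtState A B τ) π (k + 1) := by
  have hx := hX.measurable_samples τ
  have hx' := measurable_dtState A B τ
  have hi : Integrable (samples X τ k) P := (hX.memLp (k * τ)).integrable one_le_two
  have hlaw := hX.map_samples τ (k + 1)
  have hi' : Integrable (dtState A B τ k) (dtSource S₀) := by
    have h1 : P.map (samples X τ k) = (dtSource S₀).map (dtState A B τ k) := by
      have h := congrArg (Measure.map fun v : Fin (k + 1) → Vec n => v (Fin.last k)) hlaw
      rw [Measure.map_map (by fun_prop) (by fun_prop),
        Measure.map_map (by fun_prop) (by fun_prop)] at h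
      exact h
    have h2 : Integrable id (P.map (samples X τ k)) :=
      (integrable_map_measure (by fun_prop) (hx k).aemeasurable).2 hi
    rw [h1] at h2
    exact (integrable_map_measure (by fun_prop) (hx' k).aemeasurable).1 h2
  rw [lintegral_error_estimate P hx π k hi hw,
    lintegral_error_estimate (dtSource S₀) hx' π k hi' hw, jointLaw_congr_law hx hx' π hlaw]

/-- A policy that meets the continuous-time constraint meets the discrete-time one. -/
lemma IsSolution.dtDistortion_le (hX : IsSolution P A B S₀ W X) {τ : ℝ≥0} (hτ : 0 < τ) {D : ℝ}
    (hD : 0 < D) (π : CausalPolicy (Vec n) Packet)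
    (h : (ctDistortion P X τ π : EReal) ≤ (D : EReal)) :
    (dtDistortion A B S₀ (Qbar A τ) τ π : EReal) ≤ ((D * τ - bBar A B τ : ℝ) : EReal) := by
  have hτ' : (0 : ℝ) < τ := hτ
  have hb := bBar_nonneg A B τ.coe_nonneg
  have hct : ctDistortion P X τ π ≤ ENNReal.ofReal D := by
    rw [← EReal.coe_ennreal_le_coe_ennreal_iff, EReal.coe_ennreal_ofReal, max_eq_left hD.le]
    exact h
  -- For `D' > D` the averages are eventually below `D'`, in particular along `T = Kτ`, where they
  -- split exactly by periods. Letting `D'` decrease to `D` concludes.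
  have key : ∀ D' > D, (dtDistortion A B S₀ (Qbar A τ) τ π : EReal)
      ≤ ((D' * τ - bBar A B τ : ℝ) : EReal) := by
    intro D' hD'
    have hD0 : 0 ≤ D' := hD.le.trans hD'.le
    have hlt : ctDistortion P X τ π < ENNReal.ofReal D' :=
      hct.trans_lt ((ENNReal.ofReal_lt_ofReal_iff (hD.trans hD')).2 hD')
    have hev := eventually_lt_of_limsup_lt hlt
    have htend : Tendsto (fun K : ℕ => (K : ℝ) * τ) atTop atTop :=
      tendsto_natCast_atTop_atTop.atTop_mul_const hτ'
    have hbound : ∀ᶠ K : ℕ in atTop, (∑ k ∈ Finset.range K,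
        ∫⁻ p, weightedSq (Qbar A τ) (dtState A B τ k p.1
            - estimate (dtSource S₀) (dtState A B τ) π k (dtState A B τ k) p)
          ∂jointLaw (dtSource S₀) (dtState A B τ) π (k + 1)) / (K : ℝ≥0∞)
        + ENNReal.ofReal (bBar A B τ) ≤ ENNReal.ofReal (D' * τ) := by
      filter_upwards [htend.eventually hev, eventually_gt_atTop 0] with K hK hK0
      have hK0' : (K : ℝ≥0∞) ≠ 0 := by simpa using hK0.ne'
      have hKτ : 0 < (K : ℝ) * τ := by positivity
      rw [hX.lintegral_ctError τ π K] at hK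
      simp_rw [hX.lintegral_error_samples τ π _ (measurable_weightedSq (Qbar A τ))] at hK
      have h1 := (ENNReal.div_le_iff (ENNReal.ofReal_pos.2 hKτ).ne' ENNReal.ofReal_ne_top).1 hK.le
      have h2 : ENNReal.ofReal (bBar A B τ)
          = (K * ENNReal.ofReal (bBar A B τ)) / K := by
        rw [mul_comm, ENNReal.mul_div_cancel_right hK0' (ENNReal.natCast_ne_top K)]
      rw [h2, ← ENNReal.add_div]
      refine ENNReal.div_le_of_le_mul (h1.trans_eq ?_)
      rw [ENNReal.ofReal_mul hD0, ENNReal.ofReal_mul (Nat.cast_nonneg K), ENNReal.ofReal_natCast]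
      ring
    -- One such `K` already forces `b̄_τ ≤ D' τ`, so the discrete budget for `D'` is nonnegative and
    -- `ENNReal.ofReal` does not truncate it.
    obtain ⟨K, hK⟩ := hbound.exists
    have hbD : bBar A B τ ≤ D' * τ :=
      (ENNReal.ofReal_le_ofReal_iff (by positivity)).1 (le_add_self.trans hK)
    have hle : dtDistortion A B S₀ (Qbar A τ) τ π ≤ ENNReal.ofReal (D' * τ - bBar A B τ) := by
      refine limsup_le_of_le (by isBoundedDefault) ?_
      filter_upwards [hbound] with K hK
      rw [ENNReal.ofReal_sub _ hb]
      exact ENNReal.le_sub_of_add_le_right ENNReal.ofReal_ne_top hK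
    rw [← EReal.coe_ennreal_le_coe_ennreal_iff, EReal.coe_ennreal_ofReal,
      max_eq_left (sub_nonneg.2 hbD)] at hle
    exact hle
  have hlim : Tendsto (fun D' : ℝ => ((D' * τ - bBar A B τ : ℝ) : EReal))
      (nhdsWithin D (Set.Ioi D)) (nhds ((D * τ - bBar A B τ : ℝ) : EReal)) := by
    have hc : Continuous fun D' : ℝ => ((D' * τ - bBar A B τ : ℝ) : EReal) :=
      continuous_coe_real_ereal.comp (by fun_prop)
    exact (hc.tendsto D).mono_left nhdsWithin_le_nhds
  exact ge_of_tendsto hlim (eventually_mem_nhdsWithin.mono key)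

/-- Both infima range over the same policies with equal bitrates, and the continuous-time constraint
is the stronger one. -/
lemma IsSolution.minBitrateDT_le (hX : IsSolution P A B S₀ W X) {τ : ℝ≥0} (hτ : 0 < τ) {D : ℝ}
    (hD : 0 < D) :
    minBitrateDT A B S₀ (D * τ - bBar A B τ) (Qbar A τ) τ ≤ minBitrateCT P X D τ := by
  refine le_iInf₂ fun π hπ => ?_
  rw [bitrate_congr_law (hX.measurable_samples τ) (measurable_dtState A B τ) (hX.map_samples τ)]
  exact iInf₂_le π (hX.dtDistortion_le hτ hD π hπ)

end Distortion

end CausalCoding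

end

theorem theorem2 {n : ℕ} {Ω : Type*} [MeasurableSpace Ω] (P : Measure Ω) [IsProbabilityMeasure P]
    (A B S₀ : Matrix (Fin n) (Fin n) ℝ) (hA : IsHurwitz A) (hB : (B * Bᵀ).PosDef)
    (hS₀ : S₀.PosDef) (W X : ℝ≥0 → Ω → Vec n) (hX : IsSolution P A B S₀ W X)
    (τ : ℝ≥0) (hτ : 0 < τ) (D : ℝ) (hD : 0 < D) :
    StrictMonoOn theta (Set.Ici 0) ∧ ConcaveOn ℝ (Set.Ici 0) theta ∧
      Set.BijOn theta (Set.Ici 0) (Set.Ici 0) ∧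
    minBitrateDT A B S₀ (D * τ - bBar A B τ) (Qbar A τ) τ ≤ minBitrateCT P X D τ ∧
    thetaInvExt (causalRDF A B S₀ (D * τ - bBar A B τ) (Qbar A τ) τ) / τ
      ≤ minBitrateDT A B S₀ (D * τ - bBar A B τ) (Qbar A τ) τ := by
  exact ⟨strictMonoOn_theta, concaveOn_theta, bijOn_theta, hX.minBitrateDT_le hτ hD,
    thetaInvExt_causalRDF_le A B S₀ (Qbar A τ) (D * τ - bBar A B τ) hτ⟩
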